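/- Let $k$ be an algebraically closed field of characteristic zero and let $C$ be a coalgebra over $k$, with dual algebra $C^*=\mathrm{Hom}_k(C,k)$ under the convolution product $(f*g)(c)=\sum f(c_1)g(c_2)$. Assume that $C$ is artinian, i.e. $C$ is artinian both as a left $C^*$-module (action $f\rightharpoonup c=\sum c_1f(c_2)$) and as a right $C^*$-module (action $c\leftharpoonup f=\sum f(c_1)c_2$). A left $C$-comodule $M$ is called quasi-finite if $\mathrm{Hom}_C(K,M)$ is finite-dimensional for every finite-dimensional left $C$-comodule $K$. We say that $C$ satisfies the left $\chi$-condition if, for every quasi-finite left $C$-comodule $M$, every simple left $C$-comodule $S$ and every $i\ge 0$, the space $\mathrm{Ext}^i_C(M,S)$ (computed in the abelian category of left $C$-comodules) is finite-dimensional over $k$. A (left and right) noetherian $k$-algebra $A$ with Jacobson radical $J$ such that $A/J$ is finite-dimensional satisfies the left $\chi$-condition if, for every finitely generated left $A$-module $N$ and every $i\ge 0$, the space $\mathrm{Ext}^i_A(A/J,N)$ (computed in the category of left $A$-modules) is finite-dimensional over $k$. Then $C^*$ is left and right noetherian and $C^*/J(C^*)$ is finite-dimensional, and $C$ satisfies the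 left $\chi$-condition if and only if $C^*$ satisfies the left $\chi$-condition. -/

import Mathlib

open CategoryTheory CategoryTheory.Limits MonoidalCategory TensorProduct

universe u

/-! ### The dual algebra of a coalgebra and artinian coalgebras -/

section Dual

variable (k C : Type u) [Field k] [AddCommGroup C] [Module k C] [Coalgebra k C]

/-- The dual algebra `C*`: linear functionals on `C` with the convolution product
`(f * g)(c) = ∑ f(c₁) g(c₂)` and unit `ε`. -/
abbrev DualAlgebra : Type u := WithConv (C →ₗ[k] k)

/-- `C` as a left `C*`-module: `f ⇀ c = ∑ c₁ f(c₂)`. -/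
@[reducible] noncomputable def leftDualModule : Module (DualAlgebra k C) C where
  smul f c := TensorProduct.rid k C (f.ofConv.lTensor C (Coalgebra.comul c))
  one_smul c := by
    change TensorProduct.rid k C
      ((WithConv.ofConv (1 : DualAlgebra k C)).lTensor C (Coalgebra.comul c)) = c
    have h : WithConv.ofConv (1 : DualAlgebra k C) = Coalgebra.counit := by
      ext x; simp [LinearMap.convOne_def]
    rw [h]; simp
  mul_smul f g c := by
    change TensorProduct.rid k C ((f * g).ofConv.lTensor C (Coalgebra.comul c)) =
      TensorProduct.rid k C (f.ofConv.lTensor C (Coalgebra.comul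
        (TensorProduct.rid k C (g.ofConv.lTensor C (Coalgebra.comul c)))))
    have h1 : ∀ z : C ⊗[k] C,
        f.ofConv.lTensor C (Coalgebra.comul (TensorProduct.rid k C (g.ofConv.lTensor C z))) =
          (TensorProduct.map LinearMap.id ((TensorProduct.rid k k).toLinearMap ∘ₗ
            TensorProduct.map f.ofConv g.ofConv))
            (TensorProduct.assoc k C C C (Coalgebra.comul.rTensor C z)) := by
      intro z
      induction z with
      | zero => simp
      | add x y hx hy => simp only [map_add, hx, hy]
      | tmul a b =>
        simp only [LinearMap.lTensor_tmul, LinearMap.rTensor_tmul, TensorProduct.rid_tmul, map_smul]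
        generalize (Coalgebra.comul (R := k) a) = w
        induction w with
        | zero => simp
        | add x y hx hy => simp only [map_add, smul_add, TensorProduct.add_tmul, hx, hy]
        | tmul x y => simp [TensorProduct.smul_tmul, TensorProduct.smul_tmul', mul_comm]
    rw [h1, Coalgebra.coassoc_apply]
    congr 1
    generalize (Coalgebra.comul (R := k) c) = w
    induction w with
    | zero => simp
    | add x y hx hy => simp only [map_add, hx, hy]
    | tmul x y =>
      simp only [LinearMap.lTensor_tmul, TensorProduct.map_tmul, LinearMap.id_apply]
      congr 1
      change LinearMap.mul' k k (TensorProduct.map f.ofConv g.ofConv (Coalgebra.comul y)) = _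
      generalize (Coalgebra.comul (R := k) y) = w
      induction w with
      | zero => simp
      | add x y hx hy => simp only [map_add, hx, hy]
      | tmul x y => simp [mul_comm]
  smul_zero f := by
    change TensorProduct.rid k C (f.ofConv.lTensor C (Coalgebra.comul 0)) = 0
    simp
  smul_add f c d := by
    change TensorProduct.rid k C (f.ofConv.lTensor C (Coalgebra.comul (c + d))) =
      TensorProduct.rid k C (f.ofConv.lTensor C (Coalgebra.comul c)) +
      TensorProduct.rid k C (f.ofConv.lTensor C (Coalgebra.comul d))
    simp
  add_smul f g c := by
    change TensorProduct.rid k C ((f + g).ofConv.lTensor C (Coalgebra.comul c)) =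
      TensorProduct.rid k C (f.ofConv.lTensor C (Coalgebra.comul c)) +
      TensorProduct.rid k C (g.ofConv.lTensor C (Coalgebra.comul c))
    simp [LinearMap.lTensor_add]
  zero_smul c := by
    change TensorProduct.rid k C
      ((WithConv.ofConv (0 : DualAlgebra k C)).lTensor C (Coalgebra.comul c)) = 0
    simp

/-- `C` as a right `C*`-module: `c ↼ f = ∑ f(c₁) c₂`. -/
@[reducible] noncomputable def rightDualModule : Module (DualAlgebra k C)ᵐᵒᵖ C where
  smul f c := TensorProduct.lid k C (f.unop.ofConv.rTensor C (Coalgebra.comul c))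
  one_smul c := by
    change TensorProduct.lid k C
      ((WithConv.ofConv (1 : DualAlgebra k C)).rTensor C (Coalgebra.comul c)) = c
    have h : WithConv.ofConv (1 : DualAlgebra k C) = Coalgebra.counit := by
      ext x; simp [LinearMap.convOne_def]
    rw [h]; simp
  mul_smul f g c := by
    change TensorProduct.lid k C ((g.unop * f.unop).ofConv.rTensor C (Coalgebra.comul c)) =
      TensorProduct.lid k C (f.unop.ofConv.rTensor C (Coalgebra.comul
        (TensorProduct.lid k C (g.unop.ofConv.rTensor C (Coalgebra.comul c)))))
    generalize f.unop = f
    generalize g.unop = g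
    have h1 : ∀ z : C ⊗[k] C,
        f.ofConv.rTensor C (Coalgebra.comul (TensorProduct.lid k C (g.ofConv.rTensor C z))) =
          (TensorProduct.map ((TensorProduct.lid k k).toLinearMap ∘ₗ
            TensorProduct.map g.ofConv f.ofConv) LinearMap.id)
            ((TensorProduct.assoc k C C C).symm (Coalgebra.comul.lTensor C z)) := by
      intro z
      induction z with
      | zero => simp
      | add x y hx hy => simp only [map_add, hx, hy]
      | tmul a b =>
        simp only [LinearMap.lTensor_tmul, LinearMap.rTensor_tmul, TensorProduct.lid_tmul, map_smul]
        generalize (Coalgebra.comul (R := k) b) = w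
        induction w with
        | zero => simp
        | add x y hx hy => simp only [map_add, smul_add, TensorProduct.tmul_add, hx, hy]
        | tmul x y => simp [TensorProduct.smul_tmul']
    rw [h1, Coalgebra.coassoc_symm_apply]
    congr 1
    generalize (Coalgebra.comul (R := k) c) = w
    induction w with
    | zero => simp
    | add x y hx hy => simp only [map_add, hx, hy]
    | tmul x y =>
      simp only [LinearMap.rTensor_tmul, TensorProduct.map_tmul, LinearMap.id_apply]
      congr 1
  smul_zero f := by
    change TensorProduct.lid k C (f.unop.ofConv.rTensor C (Coalgebra.comul 0)) = 0
    simp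
  smul_add f c d := by
    change TensorProduct.lid k C (f.unop.ofConv.rTensor C (Coalgebra.comul (c + d))) =
      TensorProduct.lid k C (f.unop.ofConv.rTensor C (Coalgebra.comul c)) +
      TensorProduct.lid k C (f.unop.ofConv.rTensor C (Coalgebra.comul d))
    simp
  add_smul f g c := by
    change TensorProduct.lid k C ((f.unop + g.unop).ofConv.rTensor C (Coalgebra.comul c)) =
      TensorProduct.lid k C (f.unop.ofConv.rTensor C (Coalgebra.comul c)) +
      TensorProduct.lid k C (g.unop.ofConv.rTensor C (Coalgebra.comul c))
    simp [LinearMap.rTensor_add]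
  zero_smul c := by
    change TensorProduct.lid k C
      ((WithConv.ofConv (0 : DualAlgebra k C)).rTensor C (Coalgebra.comul c)) = 0
    simp

/-- `C` is artinian (on both sides): it satisfies the descending chain condition on
`C*`-submodules both as a left and as a right `C*`-module. -/
structure IsArtinianCoalgebra : Prop where
  left : @IsArtinian (DualAlgebra k C) C _ _ (leftDualModule k C)
  right : @IsArtinian (DualAlgebra k C)ᵐᵒᵖ C _ _ (rightDualModule k C)

end Dual

/-! ### The abelian category of left comodules -/

section Comodule

variable (k C : Type u) [Field k] [AddCommGroup C] [Module k C] [Coalgebra k C]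

/-- `ε ⊗ 1 : C ⊗ V → k ⊗ V ≅ V`. -/
noncomputable def tensorCounit (V : Type u) [AddCommGroup V] [Module k V] : C ⊗[k] V →ₗ[k] V :=
  (TensorProduct.lid k V).toLinearMap ∘ₗ (Coalgebra.counit (R := k) (A := C)).rTensor V

/-- `Δ ⊗ 1 : C ⊗ V → (C ⊗ C) ⊗ V ≅ C ⊗ (C ⊗ V)`. -/
noncomputable def tensorComul (V : Type u) [AddCommGroup V] [Module k V] :
    C ⊗[k] V →ₗ[k] C ⊗[k] (C ⊗[k] V) :=
  (TensorProduct.assoc k C C V).toLinearMap ∘ₗ (Coalgebra.comul (R := k) (A := C)).rTensor V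

section

variable (V W : Type u) [AddCommGroup V] [Module k V] [AddCommGroup W] [Module k W]

theorem tensorCounit_naturality (f : V →ₗ[k] W) :
    tensorCounit k C W ∘ₗ f.lTensor C = f ∘ₗ tensorCounit k C V := by
  ext c v
  simp [tensorCounit]

theorem tensorComul_naturality (f : V →ₗ[k] W) :
    tensorComul k C W ∘ₗ f.lTensor C = (f.lTensor C).lTensor C ∘ₗ tensorComul k C V := by
  ext c v
  simp only [tensorComul, TensorProduct.AlgebraTensorModule.curry_apply, TensorProduct.curry_apply,
    LinearMap.restrictScalars_self, LinearMap.comp_apply, LinearMap.lTensor_tmul,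
    LinearMap.rTensor_tmul, LinearEquiv.coe_coe]
  generalize (Coalgebra.comul (R := k) c) = w
  induction w with
  | zero => simp
  | add x y hx hy => simp only [map_add, TensorProduct.add_tmul, hx, hy]
  | tmul x y => simp

theorem tensorComul_coassoc :
    (tensorComul k C V).lTensor C ∘ₗ tensorComul k C V =
      tensorComul k C (C ⊗[k] V) ∘ₗ tensorComul k C V := by
  ext c v
  have h1 : ∀ w : C ⊗[k] C, (tensorComul k C V).lTensor C (TensorProduct.assoc k C C V (w ⊗ₜ v)) =
      ((TensorProduct.assoc k C C V).toLinearMap.lTensor C) (TensorProduct.assoc k C (C ⊗[k] C) V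
        ((Coalgebra.comul.lTensor C w) ⊗ₜ v)) := by
    intro w
    induction w with
    | zero => simp
    | add x y hx hy => simp only [map_add, TensorProduct.add_tmul, hx, hy]
    | tmul x y => simp [tensorComul]
  have h2 : ∀ w : C ⊗[k] C, tensorComul k C (C ⊗[k] V) (TensorProduct.assoc k C C V (w ⊗ₜ v)) =
      ((TensorProduct.assoc k C C V).toLinearMap.lTensor C) (TensorProduct.assoc k C (C ⊗[k] C) V
        ((TensorProduct.assoc k C C C (Coalgebra.comul.rTensor C w)) ⊗ₜ v)) := by
    intro w
    induction w with
    | zero => simp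
    | add x y hx hy => simp only [map_add, TensorProduct.add_tmul, hx, hy]
    | tmul x y =>
      simp only [tensorComul, LinearMap.comp_apply, TensorProduct.assoc_tmul,
        LinearMap.rTensor_tmul, LinearEquiv.coe_coe]
      generalize (Coalgebra.comul (R := k) x) = z
      induction z with
      | zero => simp
      | add x y hx hy => simp only [map_add, TensorProduct.add_tmul, hx, hy]
      | tmul x y => simp
  have h3 : tensorComul k C V (c ⊗ₜ v) = TensorProduct.assoc k C C V (Coalgebra.comul c ⊗ₜ v) := rfl
  change (tensorComul k C V).lTensor C (tensorComul k C V (c ⊗ₜ v)) =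
    tensorComul k C (C ⊗[k] V) (tensorComul k C V (c ⊗ₜ v))
  rw [h3, h1, h2, Coalgebra.coassoc_apply]

theorem tensorCounit_comp_tensorComul :
    tensorCounit k C (C ⊗[k] V) ∘ₗ tensorComul k C V = LinearMap.id := by
  ext c v
  have h1 : ∀ w : C ⊗[k] C, tensorCounit k C (C ⊗[k] V) (TensorProduct.assoc k C C V (w ⊗ₜ v)) =
      TensorProduct.lid k C (Coalgebra.counit.rTensor C w) ⊗ₜ v := by
    intro w
    induction w with
    | zero => simp
    | add x y hx hy => simp only [map_add, TensorProduct.add_tmul, hx, hy]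
    | tmul x y => simp [tensorCounit, TensorProduct.smul_tmul']
  change tensorCounit k C (C ⊗[k] V) (TensorProduct.assoc k C C V (Coalgebra.comul c ⊗ₜ v)) = _
  rw [h1]
  simp

theorem lTensor_tensorCounit_comp_tensorComul :
    (tensorCounit k C V).lTensor C ∘ₗ tensorComul k C V = LinearMap.id := by
  ext c v
  have h1 : ∀ w : C ⊗[k] C, (tensorCounit k C V).lTensor C (TensorProduct.assoc k C C V (w ⊗ₜ v)) =
      TensorProduct.rid k C (Coalgebra.counit.lTensor C w) ⊗ₜ v := by
    intro w
    induction w with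
    | zero => simp
    | add x y hx hy => simp only [map_add, TensorProduct.add_tmul, hx, hy]
    | tmul x y => simp [tensorCounit, TensorProduct.smul_tmul]
  change (tensorCounit k C V).lTensor C
    (TensorProduct.assoc k C C V (Coalgebra.comul c ⊗ₜ v)) = _
  rw [h1]
  simp

end

/-- The comonad `V ↦ C ⊗ V` on `k`-vector spaces, with counit `ε ⊗ 1` and
comultiplication `Δ ⊗ 1`. -/
noncomputable def tensorComonad : Comonad (ModuleCat.{u} k) where
  toFunctor := tensorLeft (ModuleCat.of k C)
  ε :=
    { app := fun V => ModuleCat.ofHom (tensorCounit k C V)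
      naturality := fun V W f => ModuleCat.hom_ext (tensorCounit_naturality k C V W f.hom) }
  δ :=
    { app := fun V => ModuleCat.ofHom (tensorComul k C V)
      naturality := fun V W f => ModuleCat.hom_ext (tensorComul_naturality k C V W f.hom) }
  coassoc V := ModuleCat.hom_ext (tensorComul_coassoc k C V)
  left_counit V := ModuleCat.hom_ext (tensorCounit_comp_tensorComul k C V)
  right_counit V := ModuleCat.hom_ext (lTensor_tensorCounit_comp_tensorComul k C V)

instance : (tensorComonad k C).toFunctor.Additive :=
  inferInstanceAs (tensorLeft (ModuleCat.of k C)).Additive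

instance : (tensorComonad k C).toFunctor.Linear k :=
  inferInstanceAs ((tensorLeft (ModuleCat.of k C)).Linear k)

instance : PreservesFiniteLimits (tensorComonad k C).toFunctor :=
  inferInstanceAs (PreservesFiniteLimits (tensorLeft (ModuleCat.of k C)))

/-- The category of left `C`-comodules: an object is a vector space `M = M.A` with a linear
coaction `ρ = M.a : M → C ⊗ M` such that `(ε ⊗ 1) ρ = 1` and `(Δ ⊗ 1) ρ = (1 ⊗ ρ) ρ`; a morphism
`f` is a linear map with `ρ f = (1 ⊗ f) ρ`. -/
abbrev LeftComodule : Type (u + 1) := (tensorComonad k C).Coalgebra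

noncomputable instance : Linear k (LeftComodule k C) where
  homModule M N :=
    { smul := fun r f =>
        { f := r • f.f
          h := by rw [Functor.map_smul, Linear.comp_smul, f.h, Linear.smul_comp] }
      one_smul := fun f => Comonad.Coalgebra.Hom.ext (one_smul k f.f)
      mul_smul := fun r s f => Comonad.Coalgebra.Hom.ext (mul_smul r s f.f)
      smul_zero := fun r => Comonad.Coalgebra.Hom.ext (smul_zero r)
      smul_add := fun r f g => Comonad.Coalgebra.Hom.ext (smul_add r f.f g.f)
      add_smul := fun r s f => Comonad.Coalgebra.Hom.ext (add_smul r s f.f)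
      zero_smul := fun f => Comonad.Coalgebra.Hom.ext (zero_smul k f.f) }
  smul_comp _ _ _ r f g := Comonad.Coalgebra.Hom.ext (Linear.smul_comp _ _ _ r f.f g.f)
  comp_smul _ _ _ f r g := Comonad.Coalgebra.Hom.ext (Linear.comp_smul _ _ _ f.f r g.f)

instance : HasFiniteLimits (LeftComodule k C) where
  out _ _ _ := hasLimitsOfShape_of_hasLimitsOfShape_createsLimitsOfShape
    (Comonad.forget (tensorComonad k C))

instance : HasFiniteColimits (LeftComodule k C) where
  out _ _ _ := hasColimitsOfShape_of_hasColimitsOfShape_createsColimitsOfShape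
    (Comonad.forget (tensorComonad k C))

instance {M N : LeftComodule k C} (f : M ⟶ N) : IsIso (Abelian.coimageImageComparison f) :=
  have := IsIso.of_isIso_fac_right (Abelian.PreservesCoimage.hom_coimageImageComparison
    (Comonad.forget (tensorComonad k C)) f).symm
  isIso_of_reflects_iso _ (Comonad.forget (tensorComonad k C))

noncomputable instance : Abelian (LeftComodule k C) := Abelian.ofCoimageImageComparisonIsIso

instance : HasExt.{u + 1} (LeftComodule k C) := HasExt.standard _

variable {k C} in
/-- A left comodule `M` is quasi-finite if `Hom_C(K, M)` is finite-dimensional for every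
finite-dimensional left comodule `K`. -/
def LeftComodule.IsQuasiFinite (M : LeftComodule k C) : Prop :=
  ∀ K : LeftComodule k C, FiniteDimensional k K.A → FiniteDimensional k (K ⟶ M)

variable {k C} in
/-- The `χ`-condition on a (quasi-finite) left comodule `M`: `Ext_C^i(M, S)`, computed in the
category of left comodules, is finite-dimensional for every simple `S` and every `i ≥ 0`. -/
def LeftComodule.SatisfiesChi (M : LeftComodule k C) : Prop :=
  ∀ S : LeftComodule k C, Simple S → ∀ i : ℕ, FiniteDimensional k (Abelian.Ext M S i)

/-- The left `χ`-condition on the coalgebra `C`. -/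
def Coalgebra.SatisfiesLeftChi : Prop :=
  ∀ M : LeftComodule k C, M.IsQuasiFinite → M.SatisfiesChi

end Comodule

/-! ### The `χ`-condition for algebras -/

section Algebra

variable (k A : Type u) [Field k] [Ring A] [Algebra k A]

/-- The `χ`-condition on a (finitely generated) left `A`-module `M`: `Ext_A^i(A/J, M)` is
finite-dimensional for every `i ≥ 0`, where `J` is the Jacobson radical of `A`. -/
def ModuleCat.SatisfiesChi (M : ModuleCat.{u} A) : Prop :=
  ∀ i : ℕ, FiniteDimensional k (Abelian.Ext (ModuleCat.of A (A ⧸ Ring.jacobson A)) M i)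

/-- The left `χ`-condition on the algebra `A`. -/
def Algebra.SatisfiesLeftChi : Prop :=
  ∀ M : ModuleCat.{u} A, Module.Finite A M → ModuleCat.SatisfiesChi k A M

end Algebra

/-! Write `A` for the dual algebra. The proof rests on the exact contravariant functor `M ↦ M*` from
left comodules to left `A`-modules. Morphisms into a cofree comodule `C ⊗ W` are linear maps into
`W`, so `C ⊗ W` is injective; for finite-dimensional `W` its dual is free over `A` of rank `dim W`.
Hence transposition is bijective on morphisms into such cofree comodules and, by embedding, into any
artinian comodule `X` (`dualMap_surjective`). Since `C` is artinian, `X` is resolved by cofree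
comodules of finite rank with artinian cokernels, and dimension shifting gives `Ext_C^i(M, X) ≅
Ext_A^i(X*, M*)` (`nonempty_ext_equiv_dual`).

The objects on the two sides also match. The quasi-finite comodules are the subcomodules of cofree
comodules of finite rank (`IsQuasiFinite.exists_mono_cofree`, `isQuasiFinite_of_mono`), and every
finitely generated `A`-module is the dual of one (`exists_dual_equiv`). The dual of a simple
comodule is simple, hence a summand of `A/J`; conversely `A/J` is the dual of a finite-dimensional
comodule, which is filtered by simple ones.

The ring-theoretic claims come from the pairing of `A` with `C`. Right multiplication by `f` is the
transpose of `f ⇀`, and a finitely generated left ideal is the annihilator of the common kernel of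
its generators, so descending chains in `C` control ascending chains of ideals. The socle of `C` is
finite-dimensional, and functionals vanishing on it lie in `J`. -/

/-! ### Pairing formulas for the actions of the dual algebra -/

section DualAlgebraActions

variable {k C : Type u} [Field k] [AddCommGroup C] [Module k C] [Coalgebra k C]

namespace DualAlgebra

theorem mul_apply (f g : DualAlgebra k C) (c : C) :
    (f * g).ofConv c =
      LinearMap.mul' k k (TensorProduct.map f.ofConv g.ofConv (Coalgebra.comul c)) := rfl

theorem one_apply (c : C) : (1 : DualAlgebra k C).ofConv c = Coalgebra.counit (R := k) c := by
  simp [LinearMap.convOne_def]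

/-- The left action `f ⇀ c = ∑ c₁ f(c₂)` as a linear endomorphism of `C`. -/
noncomputable def leftAct (f : DualAlgebra k C) : C →ₗ[k] C :=
  (TensorProduct.rid k C).toLinearMap ∘ₗ f.ofConv.lTensor C ∘ₗ Coalgebra.comul

/-- The right action `c ↼ f = ∑ f(c₁) c₂` as a linear endomorphism of `C`. -/
noncomputable def rightAct (f : DualAlgebra k C) : C →ₗ[k] C :=
  (TensorProduct.lid k C).toLinearMap ∘ₗ f.ofConv.rTensor C ∘ₗ Coalgebra.comul

theorem apply_leftAct (f g : DualAlgebra k C) (c : C) :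
    g.ofConv (leftAct f c) = (g * f).ofConv c := by
  rw [mul_apply, leftAct, LinearMap.comp_apply, LinearMap.comp_apply]
  generalize (Coalgebra.comul (R := k) c) = w
  induction w with
  | zero => simp
  | add x y hx hy => simp only [map_add, hx, hy]
  | tmul x y => simp [mul_comm]

theorem apply_rightAct (f g : DualAlgebra k C) (c : C) :
    f.ofConv (rightAct g c) = (g * f).ofConv c := by
  rw [mul_apply, rightAct, LinearMap.comp_apply, LinearMap.comp_apply]
  generalize (Coalgebra.comul (R := k) c) = w
  induction w with
  | zero => simp
  | add x y hx hy => simp only [map_add, hx, hy]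
  | tmul x y => simp

/-- Functionals separate points, so this is associativity of convolution. It makes the kernel of
`leftAct f` stable under the right action, which is why each chain condition on `C` yields the
noetherian property of the opposite side. -/
theorem leftAct_rightAct (f g : DualAlgebra k C) (c : C) :
    leftAct f (rightAct g c) = rightAct g (leftAct f c) := by
  rw [← sub_eq_zero]
  refine (Module.forall_dual_apply_eq_zero_iff k _).1 fun φ => ?_
  obtain ⟨h, rfl⟩ := WithConv.ofConv_surjective φ
  rw [map_sub, apply_leftAct, apply_rightAct, apply_rightAct, apply_leftAct, mul_assoc, sub_self]

end DualAlgebra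

end DualAlgebraActions

/-! ### Artinian coalgebras have noetherian dual algebras -/

/-- A ring `R` identified with the linear dual of `C` so that left multiplication acts through
transposes of endomorphisms `T f` of `C` is noetherian as soon as the kernels of the `T f` are
submodules of an artinian module. -/
theorem isNoetherianRing_of_isArtinian_of_dual {k C R S : Type*} [Field k] [AddCommGroup C]
    [Module k C] [Ring R] [Ring S] [Module S C] [IsArtinian S C]
    (ev : R ≃+ (C →ₗ[k] k)) (T : R → C →ₗ[k] C)
    (hT : ∀ f g, ev (g * f) = ev g ∘ₗ T f)
    (K : R → Submodule S C) (hK : ∀ f c, c ∈ K f ↔ T f c = 0) : IsNoetherianRing R := by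
  classical
  -- A functional killing the common kernel factors through the joint map `Φ`; the components of the
  -- factor are the coefficients of `g` over `s`.
  have key : ∀ (s : Finset R) (g : R), (∀ c ∈ s.inf K, ev g c = 0) →
      g ∈ Submodule.span R (s : Set R) := by
    intro s g hg
    let Φ : C →ₗ[k] (s → C) := LinearMap.pi fun f => T f
    have hker : LinearMap.ker Φ ≤ LinearMap.ker (ev g) := by
      intro c hc
      refine hg c ?_
      rw [Finset.inf_eq_iInf]
      simp only [Submodule.mem_iInf]
      intro f hf
      exact (hK f c).2 (congrFun (LinearMap.mem_ker.1 hc) ⟨f, hf⟩)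
    have hmem : ev g ∈ LinearMap.range Φ.dualMap := by
      rw [LinearMap.range_dualMap_eq_dualAnnihilator_ker, Submodule.mem_dualAnnihilator]
      exact hker
    obtain ⟨θ, hθ⟩ := hmem
    have hsum : g = ∑ f : s, ev.symm (θ ∘ₗ LinearMap.single k (fun _ : s => C) f) * (f : R) := by
      refine ev.injective (LinearMap.ext fun c => ?_)
      rw [map_sum, LinearMap.sum_apply, ← hθ]
      simp only [hT, AddEquiv.apply_symm_apply, LinearMap.comp_apply, LinearMap.dualMap_apply]
      rw [← map_sum]
      congr 1
      exact (LinearMap.sum_single_apply _ (Φ c)).symm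
    rw [hsum]
    exact Submodule.sum_mem _ fun f _ => Submodule.smul_mem _ _ (Submodule.subset_span f.2)
  refine isNoetherianRing_iff.2 ⟨fun I => ?_⟩
  -- A minimal common kernel cannot shrink when some `g ∈ I` is added, so `T g`, and with it `ev g =
  -- ev 1 ∘ T g`, vanishes there.
  obtain ⟨P, ⟨s, hs, rfl⟩, hmin⟩ := IsArtinian.set_has_minimal
    {P : Submodule S C | ∃ s : Finset R, (s : Set R) ⊆ I ∧ P = s.inf K} ⟨_, ∅, by simp, rfl⟩
  refine ⟨s, le_antisymm (Submodule.span_le.2 hs) fun g hg => key s g fun c hc => ?_⟩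
  have h1 : (insert g s).inf K ≤ s.inf K := by
    rw [Finset.inf_insert]; exact inf_le_right
  have h2 : ¬ (insert g s).inf K < s.inf K :=
    hmin _ ⟨insert g s, by simp [Set.insert_subset_iff, hs, hg], rfl⟩
  have h3 : s.inf K ≤ K g := by
    rw [← eq_of_le_of_not_lt h1 h2, Finset.inf_insert]; exact inf_le_left
  have h4 := (hK g c).1 (h3 hc)
  rw [← one_mul g, hT, LinearMap.comp_apply, h4, map_zero]

section ArtinianCoalgebra

variable (k C : Type u) [Field k] [AddCommGroup C] [Module k C] [Coalgebra k C]

theorem IsArtinianCoalgebra.isNoetherianRing (hC : IsArtinianCoalgebra k C) :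
    IsNoetherianRing (DualAlgebra k C) := by
  let _ := rightDualModule k C
  have := hC.right
  exact isNoetherianRing_of_isArtinian_of_dual (k := k) (C := C) (S := (DualAlgebra k C)ᵐᵒᵖ)
    (WithConv.addEquiv _) DualAlgebra.leftAct
    (fun f g => LinearMap.ext fun c => (DualAlgebra.apply_leftAct f g c).symm)
    (fun f =>
      { carrier := {c | DualAlgebra.leftAct f c = 0}
        zero_mem' := map_zero _
        add_mem' := fun {a b} ha hb => by
          simp only [Set.mem_ofPred_eq] at ha hb ⊢; rw [map_add, ha, hb, add_zero]
        smul_mem' := fun g c hc => by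
          have : g • c = DualAlgebra.rightAct g.unop c := rfl
          simp only [Set.mem_ofPred_eq] at hc ⊢
          rw [this, DualAlgebra.leftAct_rightAct, hc, map_zero] })
    fun f c => Iff.rfl

theorem IsArtinianCoalgebra.isNoetherianRing_op (hC : IsArtinianCoalgebra k C) :
    IsNoetherianRing (DualAlgebra k C)ᵐᵒᵖ := by
  let _ := leftDualModule k C
  have := hC.left
  exact isNoetherianRing_of_isArtinian_of_dual (k := k) (C := C) (S := DualAlgebra k C)
    (MulOpposite.opAddEquiv.symm.trans (WithConv.addEquiv _))
    (fun f => DualAlgebra.rightAct f.unop)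
    (fun f g => LinearMap.ext fun c => (DualAlgebra.apply_rightAct g.unop f.unop c).symm)
    (fun f =>
      { carrier := {c | DualAlgebra.rightAct f.unop c = 0}
        zero_mem' := map_zero _
        add_mem' := fun {a b} ha hb => by
          simp only [Set.mem_ofPred_eq] at ha hb ⊢; rw [map_add, ha, hb, add_zero]
        smul_mem' := fun g c hc => by
          have : g • c = DualAlgebra.leftAct g c := rfl
          simp only [Set.mem_ofPred_eq] at hc ⊢
          rw [this, ← DualAlgebra.leftAct_rightAct, hc, map_zero] })
    fun f c => Iff.rfl

/-- All contractions of a fixed tensor lie in a finite-dimensional subspace. -/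
theorem exists_finiteDimensional_lid_rTensor_mem {k U V : Type*} [Field k] [AddCommGroup U]
    [Module k U] [AddCommGroup V] [Module k V] (z : U ⊗[k] V) :
    ∃ W : Submodule k V, FiniteDimensional k W ∧
      ∀ f : U →ₗ[k] k, TensorProduct.lid k V (f.rTensor V z) ∈ W := by
  induction z with
  | zero => exact ⟨⊥, inferInstance, by simp⟩
  | add x y hx hy =>
    obtain ⟨W₁, _, h₁⟩ := hx
    obtain ⟨W₂, _, h₂⟩ := hy
    refine ⟨W₁ ⊔ W₂, inferInstance, fun f => ?_⟩
    rw [map_add, map_add]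
    exact add_mem (Submodule.mem_sup_left (h₁ f)) (Submodule.mem_sup_right (h₂ f))
  | tmul x y =>
    refine ⟨k ∙ y, inferInstance, fun f => ?_⟩
    simpa using Submodule.smul_mem _ (f x) (Submodule.mem_span_singleton_self y)

/-- The socle of an artinian coalgebra is finite-dimensional. -/
theorem IsArtinianCoalgebra.exists_finset_forall_isSimpleModule (hC : IsArtinianCoalgebra k C) :
    letI := rightDualModule k C
    ∃ t : Finset C, ∀ N : Submodule (DualAlgebra k C)ᵐᵒᵖ C,
      IsSimpleModule (DualAlgebra k C)ᵐᵒᵖ N → ∀ c ∈ N, c ∈ Submodule.span k (t : Set C) := by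
  let _ := rightDualModule k C
  have := hC.right
  -- The socle: semisimple and artinian, hence finitely generated.
  let D : Submodule (DualAlgebra k C)ᵐᵒᵖ C :=
    ⨆ N ∈ {N : Submodule (DualAlgebra k C)ᵐᵒᵖ C | IsSimpleModule (DualAlgebra k C)ᵐᵒᵖ N}, N
  have hD : IsSemisimpleModule (DualAlgebra k C)ᵐᵒᵖ D :=
    isSemisimpleModule_biSup_of_isSemisimpleModule_submodule fun N hN => by
      have : IsSimpleModule (DualAlgebra k C)ᵐᵒᵖ N := hN
      infer_instance
  have hart : IsArtinian (DualAlgebra k C)ᵐᵒᵖ D := inferInstance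
  have htfae := IsSemisimpleModule.finite_tfae (R := (DualAlgebra k C)ᵐᵒᵖ) (M := D)
  have hfin : Module.Finite (DualAlgebra k C)ᵐᵒᵖ D := (htfae.out 0 2).2 hart
  obtain ⟨s, hs⟩ := Module.Finite.iff_fg.1 hfin
  choose W hW hmem using fun c : C =>
    exists_finiteDimensional_lid_rTensor_mem (Coalgebra.comul (R := k) c)
  have : FiniteDimensional k (s.sup W : Submodule k C) := Submodule.finiteDimensional_finset_sup s W
  obtain ⟨t, ht⟩ : (s.sup W : Submodule k C).FG := Module.Finite.iff_fg.1 this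
  refine ⟨t, fun N hN c hc => ?_⟩
  have hcD : c ∈ D := (le_iSup₂_of_le (f := fun N _ => N) N hN le_rfl) hc
  rw [← hs] at hcD
  rw [ht]
  clear hc
  -- In this induction scalars act on generators only. That is needed because `s.sup W` is merely a
  -- `k`-subspace.
  induction hcD using Submodule.closure_induction with
  | zero => exact zero_mem _
  | add x y _ _ hx hy => exact add_mem hx hy
  | smul_mem f x hx => exact (Finset.le_sup (f := W) hx) (hmem x f.unop.ofConv)

/-- The quotient of the dual algebra of an artinian coalgebra by its radical is
finite-dimensional. -/
theorem IsArtinianCoalgebra.finiteDimensional_quotient_jacobson (hC : IsArtinianCoalgebra k C) :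
    FiniteDimensional k (DualAlgebra k C ⧸ Ring.jacobson (DualAlgebra k C)) := by
  let _ := rightDualModule k C
  have := hC.right
  obtain ⟨t, ht⟩ := hC.exists_finset_forall_isSimpleModule
  let φ : DualAlgebra k C →ₗ[k] (t → k) :=
    LinearMap.pi fun c => (LinearMap.applyₗ (c : C)) ∘ₗ
      (WithConv.linearEquiv k (C →ₗ[k] k)).toLinearMap
  have hφ : LinearMap.ker φ ≤ (Ring.jacobson (DualAlgebra k C)).restrictScalars k := by
    intro f hf
    have hft : ∀ c ∈ Submodule.span k (t : Set C), f.ofConv c = 0 := fun c hc =>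
      (Submodule.span_le (p := LinearMap.ker f.ofConv)).2
        (fun d hd => congrFun (LinearMap.mem_ker.1 hf) ⟨d, hd⟩) hc
    rw [Submodule.restrictScalars_mem, ← Ideal.jacobson_bot, Ideal.mem_jacobson_iff]
    intro g
    -- The goal is a left inverse of `1 + g * f`. Right multiplication by this element is the
    -- transpose of `T`, so injectivity of `T` suffices.
    let T : C →ₗ[k] C := DualAlgebra.leftAct (1 + g * f)
    have hT : Function.Injective T := by
      let K : Submodule (DualAlgebra k C)ᵐᵒᵖ C :=
        { carrier := {c | T c = 0}
          zero_mem' := map_zero _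
          add_mem' := fun {a b} ha hb => by
            simp only [Set.mem_ofPred_eq] at ha hb ⊢; rw [map_add, ha, hb, add_zero]
          smul_mem' := fun h c hc => by
            have : h • c = DualAlgebra.rightAct h.unop c := rfl
            simp only [Set.mem_ofPred_eq] at hc ⊢
            rw [this, DualAlgebra.leftAct_rightAct, hc, map_zero] }
      rw [injective_iff_map_eq_zero]
      intro c hc
      have hK : K = ⊥ := by
        -- A simple `N ≤ K` lies in the socle, where `f` vanishes. Hence `leftAct f` kills `N`, and
        -- `T` is both the identity and zero on it.
        by_contra hK
        obtain ⟨N, hN, hNK⟩ := (eq_bot_or_exists_atom_le K).resolve_left hK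
        refine hN.1 ((Submodule.eq_bot_iff _).2 fun n hn => ?_)
        have hn0 : DualAlgebra.leftAct f n = 0 := by
          refine (Module.forall_dual_apply_eq_zero_iff k _).1 fun χ => ?_
          obtain ⟨h, rfl⟩ := WithConv.ofConv_surjective χ
          rw [DualAlgebra.apply_leftAct, ← DualAlgebra.apply_rightAct]
          exact hft _ (ht N (isSimpleModule_iff_isAtom.2 hN) _
            (N.smul_mem (MulOpposite.op h) hn))
        refine (Module.forall_dual_apply_eq_zero_iff k _).1 fun χ => ?_
        obtain ⟨h, rfl⟩ := WithConv.ofConv_surjective χ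
        have h1 : h.ofConv (T n) = 0 := by
          rw [show T n = 0 from hNK hn, map_zero]
        rw [DualAlgebra.apply_leftAct, mul_add, mul_one, ← mul_assoc, WithConv.ofConv_add,
          LinearMap.add_apply, ← DualAlgebra.apply_leftAct f, hn0, map_zero, add_zero] at h1
        exact h1
      exact (Submodule.mem_bot (DualAlgebra k C)ᵐᵒᵖ).1 (hK ▸ (show c ∈ K from hc))
    obtain ⟨θ, hθ⟩ : ∃ θ : C →ₗ[k] k, θ ∘ₗ T = (1 : DualAlgebra k C).ofConv :=
      LinearMap.dualMap_surjective_of_injective hT _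
    refine ⟨WithConv.toConv θ, ?_⟩
    rw [Ideal.mem_bot, sub_eq_zero]
    apply WithConv.ofConv_injective
    rw [← hθ]
    ext c
    rw [LinearMap.comp_apply, DualAlgebra.apply_leftAct (1 + g * f) (WithConv.toConv θ)]
    rw [mul_add, mul_one, mul_assoc, add_comm]
  have : FiniteDimensional k (DualAlgebra k C ⧸ LinearMap.ker φ) :=
    Module.Finite.equiv φ.quotKerEquivRange.symm
  let π : (DualAlgebra k C) →ₗ[k] (DualAlgebra k C ⧸ Ring.jacobson (DualAlgebra k C)) :=
    (Submodule.mkQ (Ring.jacobson (DualAlgebra k C))).restrictScalars k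
  have hπ : LinearMap.ker φ ≤ LinearMap.ker π := fun f hf =>
    (Submodule.Quotient.mk_eq_zero _).2 ((Submodule.restrictScalars_mem k _ _).1 (hφ hf))
  refine Module.Finite.of_surjective ((LinearMap.ker φ).liftQ π hπ) fun x => ?_
  obtain ⟨f, rfl⟩ := Submodule.Quotient.mk_surjective _ x
  exact ⟨Submodule.Quotient.mk f, rfl⟩

end ArtinianCoalgebra

/-! ### Contractions -/

section Contract

variable {k C : Type u} [Field k] [AddCommGroup C] [Module k C]

/-- The contraction `f ⊗ 1 : C ⊗ V → V` along a functional `f` on `C`. -/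
noncomputable def contract (V : Type u) [AddCommGroup V] [Module k V] (f : WithConv (C →ₗ[k] k)) :
    C ⊗[k] V →ₗ[k] V :=
  (TensorProduct.lid k V).toLinearMap ∘ₗ f.ofConv.rTensor V

variable {V W : Type u} [AddCommGroup V] [Module k V] [AddCommGroup W] [Module k W]

@[simp]
theorem contract_tmul (f : WithConv (C →ₗ[k] k)) (c : C) (v : V) :
    contract V f (c ⊗ₜ v) = f.ofConv c • v := by
  simp [contract]

theorem contract_lTensor (f : WithConv (C →ₗ[k] k)) (g : V →ₗ[k] W) (z : C ⊗[k] V) :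
    contract W f (g.lTensor C z) = g (contract V f z) := by
  induction z with
  | zero => simp
  | add x y hx hy => simp only [map_add, hx, hy]
  | tmul x y => simp

theorem contract_add (f g : WithConv (C →ₗ[k] k)) (z : C ⊗[k] V) :
    contract V (f + g) z = contract V f z + contract V g z := by
  simp [contract, LinearMap.rTensor_add]

theorem contract_smul (r : k) (f : WithConv (C →ₗ[k] k)) (z : C ⊗[k] V) :
    contract V (r • f) z = r • contract V f z := by
  simp [contract, LinearMap.rTensor_smul]

theorem contract_zero (z : C ⊗[k] V) : contract V (0 : WithConv (C →ₗ[k] k)) z = 0 := by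
  simp [contract]

/-- Contractions by coordinate functionals of a basis of `C` are the coefficients of `z`.
Consequently the action of the dual algebra determines the coaction, and its linear maps and
submodules are the comodule maps and subcomodules. -/
theorem eq_zero_of_contract_eq_zero {z : C ⊗[k] V}
    (h : ∀ f : WithConv (C →ₗ[k] k), contract V f z = 0) : z = 0 := by
  classical
  let b := Module.Basis.ofVectorSpace k C
  let e := TensorProduct.equivFinsuppOfBasisLeft (N := V) b
  refine e.injective (Finsupp.ext fun i => ?_)
  rw [map_zero, Finsupp.zero_apply, ← h (WithConv.toConv (b.coord i))]
  exact TensorProduct.equivFinsuppOfBasisLeft_apply b z i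

theorem eq_of_contract_eq {z z' : C ⊗[k] V}
    (h : ∀ f : WithConv (C →ₗ[k] k), contract V f z = contract V f z') : z = z' :=
  sub_eq_zero.1 (eq_zero_of_contract_eq_zero fun f => by rw [map_sub, h, sub_self])

variable [Coalgebra k C]

theorem contract_one (z : C ⊗[k] V) :
    contract V (1 : DualAlgebra k C) z = tensorCounit k C V z := by
  induction z with
  | zero => simp
  | add x y hx hy => simp only [map_add, hx, hy]
  | tmul x y => simp [tensorCounit]

/-- The left factor is contracted first; this is why left comodules become right modules. -/
theorem contract_mul (f g : DualAlgebra k C) (z : C ⊗[k] V) :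
    contract V (f * g) z = contract V g (contract (C ⊗[k] V) f (tensorComul k C V z)) := by
  induction z with
  | zero => simp
  | add x y hx hy => simp only [map_add, hx, hy]
  | tmul x v =>
    rw [contract_tmul, DualAlgebra.mul_apply, tensorComul, LinearMap.comp_apply,
      LinearMap.rTensor_tmul, LinearEquiv.coe_coe]
    generalize (Coalgebra.comul (R := k) x) = w
    induction w with
    | zero => simp
    | add x y hx hy => simp only [map_add, add_smul, TensorProduct.add_tmul, hx, hy]
    | tmul x y => simp [mul_smul]

end Contract

/-! ### Comodules as modules over the dual algebra -/

namespace LeftComodule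

variable {k C : Type u} [Field k] [AddCommGroup C] [Module k C] [Coalgebra k C]

/-- The coaction of a left comodule as a linear map. -/
noncomputable def coaction (M : LeftComodule k C) : M.A →ₗ[k] C ⊗[k] M.A := M.a.hom

theorem tensorCounit_coaction (M : LeftComodule k C) (m : M.A) :
    tensorCounit k C M.A (M.coaction m) = m :=
  LinearMap.congr_fun (congrArg ModuleCat.Hom.hom M.counit) m

theorem tensorComul_coaction (M : LeftComodule k C) (m : M.A) :
    tensorComul k C M.A (M.coaction m) = M.coaction.lTensor C (M.coaction m) :=
  LinearMap.congr_fun (congrArg ModuleCat.Hom.hom M.coassoc) m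

theorem coaction_hom {M N : LeftComodule k C} (φ : M ⟶ N) (m : M.A) :
    N.coaction (φ.f.hom m) = φ.f.hom.lTensor C (M.coaction m) :=
  (LinearMap.congr_fun (congrArg ModuleCat.Hom.hom φ.h) m).symm

/-- A left comodule from a coaction satisfying the counit and coassociativity axioms. -/
noncomputable def ofCoaction (V : Type u) [AddCommGroup V] [Module k V] (ρ : V →ₗ[k] C ⊗[k] V)
    (h₁ : ∀ v, tensorCounit k C V (ρ v) = v)
    (h₂ : ∀ v, tensorComul k C V (ρ v) = ρ.lTensor C (ρ v)) : LeftComodule k C where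
  A := ModuleCat.of k V
  a := ModuleCat.ofHom (Y := C ⊗[k] V) ρ
  counit := ModuleCat.hom_ext (LinearMap.ext h₁)
  coassoc := ModuleCat.hom_ext (LinearMap.ext h₂)

/-- A comodule morphism from a linear map compatible with the coactions. -/
noncomputable def homMk {M N : LeftComodule k C} (f : M.A →ₗ[k] N.A)
    (hf : ∀ m, N.coaction (f m) = f.lTensor C (M.coaction m)) : M ⟶ N where
  f := ModuleCat.ofHom f
  h := ModuleCat.hom_ext (LinearMap.ext fun m => (hf m).symm)

/-- A left comodule is a right module over the dual algebra: `m f = ∑ f(m₋₁) m₀`. -/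
noncomputable instance (M : LeftComodule k C) : Module (DualAlgebra k C)ᵐᵒᵖ M.A where
  smul f m := contract M.A f.unop (M.coaction m)
  one_smul m := by
    change contract M.A (1 : DualAlgebra k C) (M.coaction m) = m
    rw [contract_one, tensorCounit_coaction]
  mul_smul f g m := by
    change contract M.A (g.unop * f.unop) (M.coaction m) =
      contract M.A f.unop (M.coaction (contract M.A g.unop (M.coaction m)))
    rw [contract_mul, tensorComul_coaction, contract_lTensor]
  smul_zero f := by
    change contract M.A f.unop (M.coaction 0) = 0
    rw [map_zero, map_zero]
  smul_add f m n := by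
    change contract M.A f.unop (M.coaction (m + n)) = _
    rw [map_add, map_add]; rfl
  add_smul f g m := contract_add f.unop g.unop _
  zero_smul _ := contract_zero _

theorem op_smul_def (M : LeftComodule k C) (f : DualAlgebra k C) (m : M.A) :
    MulOpposite.op f • m = contract M.A f (M.coaction m) := rfl

instance (M : LeftComodule k C) : IsScalarTower k (DualAlgebra k C)ᵐᵒᵖ M.A where
  smul_assoc r f _ := contract_smul r f.unop _

instance (M : LeftComodule k C) : SMulCommClass (DualAlgebra k C)ᵐᵒᵖ k M.A where
  smul_comm f r m := by
    change contract M.A f.unop (M.coaction (r • m)) = r • contract M.A f.unop (M.coaction m)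
    rw [map_smul, map_smul]

/-- Comodule morphisms are linear over the dual algebra. -/
noncomputable def toLinear {M N : LeftComodule k C} (φ : M ⟶ N) :
    M.A →ₗ[(DualAlgebra k C)ᵐᵒᵖ] N.A where
  toFun := φ.f.hom
  map_add' := map_add _
  map_smul' f m := by
    obtain ⟨f, rfl⟩ := MulOpposite.op_surjective f
    rw [RingHom.id_apply, op_smul_def, op_smul_def, coaction_hom, contract_lTensor]

/-- Maps linear over the dual algebra are comodule morphisms. -/
noncomputable def ofLinear {M N : LeftComodule k C} (f : M.A →ₗ[(DualAlgebra k C)ᵐᵒᵖ] N.A) :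
    M ⟶ N :=
  homMk (f.restrictScalars k) fun m => eq_of_contract_eq fun g => by
    rw [contract_lTensor]
    exact (f.map_smul (MulOpposite.op g) m).symm

/-- A submodule over the dual algebra is a subcomodule. -/
theorem coaction_mem_range (M : LeftComodule k C) (N : Submodule (DualAlgebra k C)ᵐᵒᵖ M.A)
    {m : M.A} (hm : m ∈ N) :
    M.coaction m ∈ LinearMap.range ((N.restrictScalars k).subtype.lTensor C) := by
  -- By right exactness, membership in the image can be tested in `C ⊗ (M / N)`.
  have hex := lTensor_exact C
    (LinearMap.exact_subtype_mkQ (N.restrictScalars k)) (Submodule.mkQ_surjective _)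
  refine (hex _).1 (eq_zero_of_contract_eq_zero fun f => ?_)
  rw [contract_lTensor]
  exact (Submodule.Quotient.mk_eq_zero _).2 (N.smul_mem (MulOpposite.op f) hm)

/-- The restriction of the coaction to a submodule over the dual algebra. -/
noncomputable def subCoaction (M : LeftComodule k C)
    (N : Submodule (DualAlgebra k C)ᵐᵒᵖ M.A) :
    N.restrictScalars k →ₗ[k] C ⊗[k] N.restrictScalars k :=
  (LinearEquiv.ofInjective ((N.restrictScalars k).subtype.lTensor C)
    (Module.Flat.lTensor_preserves_injective_linearMap _
      (Submodule.subtype_injective _))).symm.toLinearMap ∘ₗ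
    LinearMap.codRestrict _ (M.coaction ∘ₗ (N.restrictScalars k).subtype)
      fun m => M.coaction_mem_range N m.2

theorem lTensor_subtype_subCoaction (M : LeftComodule k C)
    (N : Submodule (DualAlgebra k C)ᵐᵒᵖ M.A) (m : N.restrictScalars k) :
    (N.restrictScalars k).subtype.lTensor C (M.subCoaction N m) = M.coaction m :=
  LinearEquiv.ofInjective_symm_apply ((N.restrictScalars k).subtype.lTensor C)
    (h := Module.Flat.lTensor_preserves_injective_linearMap _ (Submodule.subtype_injective _)) _

/-- The subcomodule attached to a submodule over the dual algebra. -/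
noncomputable def subcomodule (M : LeftComodule k C)
    (N : Submodule (DualAlgebra k C)ᵐᵒᵖ M.A) : LeftComodule k C :=
  ofCoaction (N.restrictScalars k) (M.subCoaction N)
    (fun m => by
      apply Subtype.ext
      have := LinearMap.congr_fun (tensorCounit_naturality k C _ _ (N.restrictScalars k).subtype)
        (M.subCoaction N m)
      rw [LinearMap.comp_apply, LinearMap.comp_apply, lTensor_subtype_subCoaction,
        tensorCounit_coaction] at this
      exact this.symm)
    (fun m => by
      -- Coassociativity is checked after embedding into `C ⊗ (C ⊗ M)`.
      have hinj := Module.Flat.lTensor_preserves_injective_linearMap (M := C) _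
        (Module.Flat.lTensor_preserves_injective_linearMap (M := C) _
          (N.restrictScalars k).subtype_injective)
      apply hinj
      have := LinearMap.congr_fun (tensorComul_naturality k C _ _ (N.restrictScalars k).subtype)
        (M.subCoaction N m)
      rw [LinearMap.comp_apply, LinearMap.comp_apply] at this
      rw [← this, lTensor_subtype_subCoaction, tensorComul_coaction,
        ← lTensor_subtype_subCoaction]
      have key : M.coaction ∘ₗ (N.restrictScalars k).subtype =
          (N.restrictScalars k).subtype.lTensor C ∘ₗ M.subCoaction N :=
        LinearMap.ext fun n => (lTensor_subtype_subCoaction M N n).symm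
      refine (LinearMap.lTensor_comp_apply C M.coaction _ _).symm.trans ?_
      rw [key]
      exact LinearMap.lTensor_comp_apply C _ _ _)

/-- Every element of a comodule generates a finite-dimensional subspace. -/
theorem exists_finiteDimensional_smul_mem (M : LeftComodule k C) (m : M.A) :
    ∃ W : Submodule k M.A, FiniteDimensional k W ∧
      ∀ f : (DualAlgebra k C)ᵐᵒᵖ, f • m ∈ W := by
  obtain ⟨W, hW, h⟩ := exists_finiteDimensional_lid_rTensor_mem (M.coaction m)
  exact ⟨W, hW, fun f => h f.unop.ofConv⟩

/-! ### The dual of a comodule -/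

/-- The dual of a left comodule is a left module over the dual algebra:
`(f h)(m) = h(m f)`. -/
noncomputable instance dualModule (M : LeftComodule k C) :
    Module (DualAlgebra k C) (M.A →ₗ[k] k) where
  smul f h := h ∘ₗ contract M.A f ∘ₗ M.coaction
  one_smul h := LinearMap.ext fun m => congrArg h (one_smul (DualAlgebra k C)ᵐᵒᵖ m)
  mul_smul f g h := LinearMap.ext fun m =>
    congrArg h (mul_smul (MulOpposite.op g) (MulOpposite.op f) m)
  smul_zero _ := LinearMap.zero_comp _
  smul_add _ _ _ := LinearMap.add_comp _ _ _
  add_smul f g h := LinearMap.ext fun m =>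
    (congrArg h (add_smul (MulOpposite.op f) (MulOpposite.op g) m)).trans (map_add h _ _)
  zero_smul h := LinearMap.ext fun m =>
    (congrArg h (zero_smul (DualAlgebra k C)ᵐᵒᵖ m)).trans (map_zero h)

theorem dual_smul_apply (M : LeftComodule k C) (f : DualAlgebra k C) (h : M.A →ₗ[k] k) (m : M.A) :
    (f • h) m = h (MulOpposite.op f • m) := rfl

theorem algebraMap_smul_dual (M : LeftComodule k C) (r : k) (h : M.A →ₗ[k] k) :
    algebraMap k (DualAlgebra k C) r • h = r • h := by
  ext m
  rw [dual_smul_apply, Algebra.algebraMap_eq_smul_one, MulOpposite.op_smul, smul_assoc,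
    MulOpposite.op_one, one_smul, map_smul, LinearMap.smul_apply]

/-- The dual of a left comodule as an object of the category of left modules over the dual
algebra. -/
noncomputable abbrev dual (M : LeftComodule k C) : ModuleCat.{u} (DualAlgebra k C) :=
  ModuleCat.of (DualAlgebra k C) (M.A →ₗ[k] k)

/-- The transpose of a comodule morphism. -/
noncomputable def dualMap {M N : LeftComodule k C} (φ : M ⟶ N) : N.dual ⟶ M.dual :=
  ModuleCat.ofHom
    { toFun := fun h => h ∘ₗ φ.f.hom
      map_add' := fun _ _ => LinearMap.add_comp _ _ _
      map_smul' := fun f h => LinearMap.ext fun m =>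
        (congrArg h ((toLinear φ).map_smul (MulOpposite.op f) m)).symm }

theorem dualMap_apply {M N : LeftComodule k C} (φ : M ⟶ N) (h : N.A →ₗ[k] k) :
    (dualMap φ).hom h = h ∘ₗ φ.f.hom := rfl

theorem dualMap_comp {M N P : LeftComodule k C} (φ : M ⟶ N) (ψ : N ⟶ P) :
    dualMap (φ ≫ ψ) = dualMap ψ ≫ dualMap φ := rfl

/-- Transposition of comodule morphisms as a linear map. -/
noncomputable def dualMapₗ (M N : LeftComodule k C) : (M ⟶ N) →ₗ[k] (N.dual ⟶ M.dual) where
  toFun := dualMap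
  map_add' φ ψ := ModuleCat.hom_ext (LinearMap.ext fun h => LinearMap.comp_add _ _ _)
  map_smul' r φ := ModuleCat.hom_ext (LinearMap.ext fun h => by
    change h ∘ₗ (r • φ.f.hom) = algebraMap k (DualAlgebra k C) r • (h ∘ₗ φ.f.hom)
    rw [algebraMap_smul_dual, LinearMap.comp_smul])

theorem dualMap_injective {M N : LeftComodule k C} :
    Function.Injective (dualMap : (M ⟶ N) → (N.dual ⟶ M.dual)) := by
  intro φ ψ h
  refine Comonad.Coalgebra.Hom.ext (ModuleCat.hom_ext (LinearMap.ext fun m => ?_))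
  rw [← sub_eq_zero]
  refine (Module.forall_dual_apply_eq_zero_iff k _).1 fun χ => ?_
  rw [map_sub, sub_eq_zero]
  exact LinearMap.congr_fun (LinearMap.congr_fun (congrArg ModuleCat.Hom.hom h) χ) m

end LeftComodule

/-! ### Slice maps -/

section Slice

variable {k W : Type u} [Field k] [AddCommGroup W] [Module k W]

/-- The slice map `C ⊗ W → C` along a functional on `W`. -/
noncomputable def slice (C : Type u) [AddCommGroup C] [Module k C] (χ : W →ₗ[k] k) :
    C ⊗[k] W →ₗ[k] C :=
  (TensorProduct.rid k C).toLinearMap ∘ₗ χ.lTensor C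

@[simp]
theorem slice_tmul {C : Type u} [AddCommGroup C] [Module k C] (χ : W →ₗ[k] k) (c : C) (w : W) :
    slice C χ (c ⊗ₜ w) = χ w • c := by
  simp [slice]

theorem eq_zero_of_slice_eq_zero {ι : Type*} (b : Module.Basis ι k W) {C : Type u}
    [AddCommGroup C] [Module k C] {z : C ⊗[k] W}
    (h : ∀ i, slice C (b.coord i) z = 0) : z = 0 := by
  classical
  refine (TensorProduct.equivFinsuppOfBasisRight b).injective (Finsupp.ext fun i => ?_)
  rw [map_zero, Finsupp.zero_apply, ← h i]
  exact TensorProduct.equivFinsuppOfBasisRight_apply b z i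

end Slice

namespace LeftComodule

variable {k C : Type u} [Field k] [AddCommGroup C] [Module k C] [Coalgebra k C]

/-! ### Exactness -/

theorem mono_iff_injective {M N : LeftComodule k C} (φ : M ⟶ N) :
    Mono φ ↔ Function.Injective φ.f.hom := by
  rw [← ModuleCat.mono_iff_injective]
  exact ((Comonad.forget (tensorComonad k C)).mono_map_iff_mono φ).symm

theorem epi_iff_surjective {M N : LeftComodule k C} (φ : M ⟶ N) :
    Epi φ ↔ Function.Surjective φ.f.hom := by
  rw [← ModuleCat.epi_iff_surjective]
  exact ((Comonad.forget (tensorComonad k C)).epi_map_iff_epi φ).symm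

instance : (Comonad.forget (tensorComonad k C)).PreservesZeroMorphisms where
  map_zero _ _ := rfl

instance : PreservesFiniteLimits (Comonad.forget (tensorComonad k C)) where
  preservesFiniteLimits _ _ _ := inferInstance

theorem function_exact {S : ShortComplex (LeftComodule k C)} (hS : S.Exact) :
    Function.Exact S.f.f.hom S.g.f.hom :=
  (ShortComplex.ShortExact.moduleCat_exact_iff_function_exact _).1
    (hS.map (Comonad.forget (tensorComonad k C)))

/-- The transpose of a short complex of comodules. -/
noncomputable abbrev dualShortComplex (S : ShortComplex (LeftComodule k C)) :
    ShortComplex (ModuleCat.{u} (DualAlgebra k C)) :=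
  ShortComplex.mk (dualMap S.g) (dualMap S.f) (by
    rw [← dualMap_comp, S.zero]
    exact (dualMapₗ _ _).map_zero)

theorem dualShortComplex_exact {S : ShortComplex (LeftComodule k C)} (hS : S.Exact) :
    (dualShortComplex S).Exact := by
  rw [ShortComplex.ShortExact.moduleCat_exact_iff_function_exact]
  have hex : LinearMap.ker (LinearMap.dualMap S.f.f.hom) =
      LinearMap.range (LinearMap.dualMap S.g.f.hom) := by
    rw [LinearMap.ker_dualMap_eq_dualAnnihilator_range,
      LinearMap.range_dualMap_eq_dualAnnihilator_ker,
      LinearMap.exact_iff.1 (function_exact hS)]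
  exact fun h => (SetLike.ext_iff.1 hex h :)

theorem dualShortComplex_shortExact {S : ShortComplex (LeftComodule k C)} (hS : S.ShortExact) :
    (dualShortComplex S).ShortExact where
  exact := dualShortComplex_exact hS.exact
  mono_f := by
    rw [ModuleCat.mono_iff_injective]
    exact LinearMap.dualMap_injective_of_surjective ((epi_iff_surjective _).1 hS.epi_g)
  epi_g := by
    rw [ModuleCat.epi_iff_surjective]
    exact LinearMap.dualMap_surjective_of_injective ((mono_iff_injective _).1 hS.mono_f)

theorem shortExact_cokernel {M N : LeftComodule k C} (φ : M ⟶ N) [Mono φ] :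
    (ShortComplex.mk φ (cokernel.π φ) (cokernel.condition φ)).ShortExact where
  exact := ShortComplex.exact_cokernel φ

/-! ### Cofree comodules -/

/-- The cofree comodule `C ⊗ W`. -/
noncomputable abbrev cofree (C W : Type u) [AddCommGroup C] [Module k C] [Coalgebra k C]
    [AddCommGroup W] [Module k W] : LeftComodule k C :=
  (tensorComonad k C).cofree.obj (ModuleCat.of k W)

/-- Vector spaces are injective, and the cofree functor is right adjoint to the forgetful functor,
which preserves monomorphisms. -/
instance (W : Type u) [AddCommGroup W] [Module k W] : Injective (cofree (k := k) C W) :=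
  have : Injective (ModuleCat.of k W) :=
    { factors := fun {X Y} g f hf => by
        obtain ⟨r, hr⟩ := LinearMap.exists_leftInverse_of_injective f.hom
          (LinearMap.ker_eq_bot.2 ((ModuleCat.mono_iff_injective f).1 hf))
        refine ⟨ModuleCat.ofHom (g.hom ∘ₗ r), ModuleCat.hom_ext ?_⟩
        rw [ModuleCat.hom_comp, ModuleCat.hom_ofHom, LinearMap.comp_assoc, hr,
          LinearMap.comp_id] }
  Injective.injective_of_adjoint (tensorComonad k C).adj _

section Cofree

variable {W : Type u} [AddCommGroup W] [Module k W]

/-- The counit `C ⊗ W → W` of a cofree comodule. -/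
noncomputable def cofreeCounit (C W : Type u) [AddCommGroup C] [Module k C] [Coalgebra k C]
    [AddCommGroup W] [Module k W] : (cofree (k := k) C W).A →ₗ[k] W :=
  tensorCounit k C W

/-- The coaction `M → C ⊗ M → C ⊗ W` followed by a linear map. -/
noncomputable def liftLinear {M : LeftComodule k C} (h : M.A →ₗ[k] W) :
    M.A →ₗ[k] (cofree (k := k) C W).A :=
  LinearMap.comp (M₂ := C ⊗[k] M.A) (M₃ := C ⊗[k] W) (h.lTensor C) M.coaction

/-- The comodule morphism to a cofree comodule attached to a linear map. -/
noncomputable def lift {M : LeftComodule k C} (h : M.A →ₗ[k] W) : M ⟶ cofree C W :=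
  homMk (liftLinear h) fun m => by
    refine (LinearMap.congr_fun (tensorComul_naturality k C _ _ h) (M.coaction m)).trans ?_
    rw [LinearMap.comp_apply, tensorComul_coaction]
    exact (LinearMap.lTensor_comp_apply C (h.lTensor C) M.coaction _).symm

theorem lift_apply {M : LeftComodule k C} (h : M.A →ₗ[k] W) (m : M.A) :
    (lift h).f.hom m = h.lTensor C (M.coaction m) := rfl

theorem cofreeCounit_lift {M : LeftComodule k C} (h : M.A →ₗ[k] W) (m : M.A) :
    cofreeCounit C W ((lift h).f.hom m) = h m := by
  refine (LinearMap.congr_fun (tensorCounit_naturality k C _ _ h) (M.coaction m)).trans ?_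
  rw [LinearMap.comp_apply, tensorCounit_coaction]

theorem lift_cofreeCounit {M : LeftComodule k C} (φ : M ⟶ cofree C W) :
    lift (cofreeCounit C W ∘ₗ φ.f.hom) = φ := by
  refine Comonad.Coalgebra.Hom.ext (ModuleCat.hom_ext (LinearMap.ext fun m => ?_))
  refine (LinearMap.lTensor_comp_apply C (cofreeCounit C W) φ.f.hom (M.coaction m)).trans ?_
  refine (congrArg _ (coaction_hom φ m).symm).trans ?_
  exact LinearMap.congr_fun (lTensor_tensorCounit_comp_tensorComul k C W) (φ.f.hom m)

/-- Morphisms to a cofree comodule are linear maps. -/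
noncomputable def homCofreeToLinear (M : LeftComodule k C) :
    (M ⟶ cofree C W) →ₗ[k] (M.A →ₗ[k] W) where
  toFun φ := cofreeCounit C W ∘ₗ φ.f.hom
  map_add' _ _ := LinearMap.comp_add _ _ _
  map_smul' _ _ := LinearMap.comp_smul _ _ _

theorem homCofreeToLinear_injective (M : LeftComodule k C) :
    Function.Injective (homCofreeToLinear (W := W) M) :=
  Function.LeftInverse.injective (g := lift) lift_cofreeCounit

/-- The slice map on a cofree comodule along a functional. -/
noncomputable def cofreeSlice (C : Type u) [AddCommGroup C] [Module k C] [Coalgebra k C]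
    (χ : W →ₗ[k] k) : (cofree (k := k) C W).A →ₗ[k] C :=
  slice C χ

theorem cofreeSlice_smul (χ : W →ₗ[k] k) (f : DualAlgebra k C) (z : (cofree (k := k) C W).A) :
    cofreeSlice C χ (MulOpposite.op f • z) = DualAlgebra.rightAct f (cofreeSlice C χ z) := by
  change slice C χ (contract (C ⊗[k] W) f (tensorComul k C W z)) =
    DualAlgebra.rightAct f (slice C χ z)
  change C ⊗[k] W at z
  induction z with
  | zero => simp
  | add x y hx hy => simp only [map_add, hx, hy]
  | tmul x w =>
    rw [slice_tmul, map_smul, DualAlgebra.rightAct, LinearMap.comp_apply, LinearMap.comp_apply,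
      tensorComul, LinearMap.comp_apply, LinearMap.rTensor_tmul]
    generalize (Coalgebra.comul (R := k) x) = w
    induction w with
    | zero => simp
    | add x y hx hy => simp only [map_add, smul_add, TensorProduct.add_tmul, hx, hy]
    | tmul x y => simp [smul_smul, mul_comm]

theorem counit_cofreeSlice (χ : W →ₗ[k] k) (z : (cofree (k := k) C W).A) :
    Coalgebra.counit (R := k) (cofreeSlice C χ z) = χ (cofreeCounit C W z) := by
  change C ⊗[k] W at z
  change Coalgebra.counit (R := k) (slice C χ z) = χ (tensorCounit k C W z)
  induction z with
  | zero => simp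
  | add x y hx hy => simp only [map_add, hx, hy]
  | tmul x w => simp [tensorCounit, mul_comm]

/-- Slicing along a basis of `W` embeds `C ⊗ W` into a finite power of `C`. -/
theorem isArtinian_cofree (hC : IsArtinianCoalgebra k C) [FiniteDimensional k W] :
    IsArtinian (DualAlgebra k C)ᵐᵒᵖ (cofree (k := k) C W).A := by
  let _ := rightDualModule k C
  have := hC.right
  let b := Module.finBasis k W
  let p : (cofree (k := k) C W).A →ₗ[(DualAlgebra k C)ᵐᵒᵖ] (Fin (Module.finrank k W) → C) :=
    { toFun := fun z i => cofreeSlice C (b.coord i) z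
      map_add' := fun x y => funext fun i => map_add (cofreeSlice C (b.coord i)) x y
      map_smul' := fun f z => funext fun i => cofreeSlice_smul (b.coord i) f.unop z }
  refine isArtinian_of_injective p ((injective_iff_map_eq_zero p).2 fun z hz => ?_)
  exact eq_zero_of_slice_eq_zero b fun i => congrFun hz i

/-- The map `A ^ n → (C ⊗ W)*` attached to a basis of `W`. -/
noncomputable def dualCofreeMap {n : ℕ} (b : Module.Basis (Fin n) k W) :
    (Fin n → DualAlgebra k C) →ₗ[DualAlgebra k C] ((cofree (k := k) C W).A →ₗ[k] k) where
  toFun F := ∑ i, (F i).ofConv ∘ₗ cofreeSlice C (b.coord i)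
  map_add' F G := LinearMap.ext fun z => by
    simp [LinearMap.sum_apply, Finset.sum_add_distrib]
  map_smul' f F := LinearMap.ext fun z => by
    rw [dual_smul_apply, LinearMap.sum_apply, LinearMap.sum_apply]
    refine Finset.sum_congr rfl fun i _ => ?_
    rw [LinearMap.comp_apply, LinearMap.comp_apply, RingHom.id_apply, cofreeSlice_smul,
      DualAlgebra.apply_rightAct]
    rfl

theorem dualCofreeMap_apply {n : ℕ} (b : Module.Basis (Fin n) k W)
    (F : Fin n → DualAlgebra k C) (z : (cofree (k := k) C W).A) :
    dualCofreeMap b F z = ∑ i, (F i).ofConv (cofreeSlice C (b.coord i) z) :=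
  LinearMap.sum_apply _ _ _

/-- The free generators are the coordinates of the counit, so a homomorphism out of the dual is
determined by its values on these functionals. -/
theorem dualCofreeMap_single {n : ℕ} (b : Module.Basis (Fin n) k W) (i : Fin n)
    (z : (cofree (k := k) C W).A) :
    dualCofreeMap b (Pi.single i (1 : DualAlgebra k C)) z = b.coord i (cofreeCounit C W z) := by
  rw [dualCofreeMap_apply, Finset.sum_eq_single i, Pi.single_eq_same, DualAlgebra.one_apply,
    counit_cofreeSlice]
  · intro j _ hj
    rw [Pi.single_eq_of_ne hj, WithConv.ofConv_zero, LinearMap.zero_apply]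
  · simp

theorem dualCofreeMap_bijective {n : ℕ} (b : Module.Basis (Fin n) k W) :
    Function.Bijective (dualCofreeMap (C := C) b) := by
  have key : ∀ (F : Fin n → DualAlgebra k C) (c : C) (i : Fin n),
      dualCofreeMap b F (c ⊗ₜ[k] b i : C ⊗[k] W) = (F i).ofConv c := by
    intro F c i
    refine (dualCofreeMap_apply b F _).trans ?_
    have h : ∀ j, cofreeSlice C (b.coord j) (c ⊗ₜ[k] b i : C ⊗[k] W) =
        (if i = j then (1 : k) else 0) • c := fun j => by
      refine (slice_tmul (b.coord j) c (b i)).trans ?_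
      rw [Module.Basis.coord_apply, Module.Basis.repr_self, Finsupp.single_apply]
    simp only [h, map_smul]
    simp
  refine ⟨fun F G h => funext fun i => WithConv.ofConv_injective (LinearMap.ext fun c => ?_),
    fun h => ⟨fun i => WithConv.toConv ((h : C ⊗[k] W →ₗ[k] k) ∘ₗ
      (TensorProduct.mk k C W).flip (b i)), ?_⟩⟩
  · rw [← key, ← key, h]
  · have hext : ∀ φ ψ : C ⊗[k] W →ₗ[k] k,
        (∀ c i, φ (c ⊗ₜ b i) = ψ (c ⊗ₜ b i)) → φ = ψ := fun φ ψ h =>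
      TensorProduct.ext (LinearMap.ext fun c => b.ext fun i => h c i)
    exact hext _ _ fun c i => key _ c i

/-- The dual of a cofree comodule of finite rank is a free module. -/
noncomputable def dualCofreeEquiv {n : ℕ} (b : Module.Basis (Fin n) k W) :
    (Fin n → DualAlgebra k C) ≃ₗ[DualAlgebra k C] ((cofree (k := k) C W).A →ₗ[k] k) :=
  LinearEquiv.ofBijective (dualCofreeMap b) (dualCofreeMap_bijective b)

instance [FiniteDimensional k W] :
    Module.Finite (DualAlgebra k C) ((cofree (k := k) C W).A →ₗ[k] k) :=
  Module.Finite.equiv (dualCofreeEquiv (Module.finBasis k W))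

instance [FiniteDimensional k W] : Projective (cofree (k := k) C W).dual :=
  have : Module.Projective (DualAlgebra k C) ((cofree (k := k) C W).A →ₗ[k] k) :=
    Module.Projective.of_equiv (dualCofreeEquiv (Module.finBasis k W))
  (IsProjective.iff_projective _).1 this

/-- Every module homomorphism from the dual of a cofree comodule of finite rank to the dual of
a comodule is a transpose. -/
theorem exists_dualMap_eq_of_cofree [FiniteDimensional k W] {M : LeftComodule k C}
    (φ : (cofree (k := k) C W).dual ⟶ M.dual) : ∃ ψ : M ⟶ cofree C W, dualMap ψ = φ := by
  let b := Module.finBasis k W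
  -- The functionals that `φ` assigns to the free generators serve as the coordinates of a linear
  -- map to `W`.
  let h : M.A →ₗ[k] W := ∑ i, LinearMap.toSpanSingleton k W (b i) ∘ₗ
    (φ.hom (dualCofreeMap b (Pi.single i 1)) : M.A →ₗ[k] k)
  refine ⟨lift h, ModuleCat.hom_ext ?_⟩
  refine (LinearMap.cancel_right (dualCofreeMap_bijective b).2).1 ?_
  refine LinearMap.pi_ext' fun i => LinearMap.ext_ring (LinearMap.ext fun m => ?_)
  refine (dualCofreeMap_single b i ((lift h).f.hom m)).trans ?_
  rw [cofreeCounit_lift]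
  simp [h, Finsupp.single_apply]

end Cofree

/-! ### Comodules that are artinian over the dual algebra -/

theorem contract_lift {M : LeftComodule k C} {W : Type u} [AddCommGroup W] [Module k W]
    (h : M.A →ₗ[k] W) (f : DualAlgebra k C) (m : M.A) :
    contract W f ((lift h).f.hom m) = h (MulOpposite.op f • m) := by
  rw [lift_apply, contract_lTensor, op_smul_def]

/-- The kernel of `lift h` is thus the largest submodule over the dual algebra contained in `ker h`.
-/
theorem lift_eq_zero_iff {M : LeftComodule k C} {W : Type u} [AddCommGroup W] [Module k W]
    (h : M.A →ₗ[k] W) (m : M.A) :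
    (lift h).f.hom m = 0 ↔ ∀ f : DualAlgebra k C, h (MulOpposite.op f • m) = 0 := by
  refine ⟨fun hm f => by
    rw [← contract_lift, hm]; exact map_zero (contract W f), fun hm => ?_⟩
  exact eq_zero_of_contract_eq_zero fun f => (contract_lift h f m).trans (hm f)

/-- An artinian comodule embeds in a cofree comodule of finite rank. -/
theorem exists_mono_cofree (X : LeftComodule k C) [IsArtinian (DualAlgebra k C)ᵐᵒᵖ X.A] :
    ∃ (W : ModuleCat.{u} k) (_ : FiniteDimensional k W) (ι : X ⟶ cofree C W), Mono ι := by
  classical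
  let P : (X.A →ₗ[k] k) → Submodule (DualAlgebra k C)ᵐᵒᵖ X.A := fun h =>
    LinearMap.ker (toLinear (lift (C := C) h))
  have hP : ∀ h x, x ∈ P h ↔ ∀ f : DualAlgebra k C, h (MulOpposite.op f • x) = 0 := fun h x =>
    lift_eq_zero_iff h x
  -- A minimal finite intersection lies in every `P h`, so all functionals vanish on it and it is
  -- zero. The finite set `t` then bounds the rank.
  obtain ⟨Q, ⟨t, rfl⟩, hmin⟩ := IsArtinian.set_has_minimal
    (Set.range fun t : Finset (X.A →ₗ[k] k) => t.inf P)
    ⟨_, ∅, rfl⟩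
  have hbot : ∀ x ∈ t.inf P, x = 0 := by
    intro x hx
    refine (Module.forall_dual_apply_eq_zero_iff k _).1 fun h => ?_
    have h1 : (insert h t).inf P ≤ t.inf P := by
      rw [Finset.inf_insert]; exact inf_le_right
    have h2 : t.inf P ≤ P h := by
      rw [← eq_of_le_of_not_lt h1 (hmin _ ⟨insert h t, rfl⟩), Finset.inf_insert]
      exact inf_le_left
    have h3 := (hP h x).1 (h2 hx) 1
    rwa [MulOpposite.op_one, one_smul] at h3
  let h : X.A →ₗ[k] (t → k) := LinearMap.pi fun h => h.1
  refine ⟨ModuleCat.of k (t → k), inferInstanceAs (FiniteDimensional k (t → k)), lift h,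
    (mono_iff_injective _).2 ((injective_iff_map_eq_zero _).2 fun x hx => hbot x ?_)⟩
  rw [Finset.inf_eq_iInf]
  simp only [Submodule.mem_iInf]
  exact fun g hg => (hP g x).2 fun f => congrFun ((lift_eq_zero_iff h x).1 hx f) ⟨g, hg⟩

theorem epi_dualMap {M N : LeftComodule k C} (φ : M ⟶ N) [Mono φ] : Epi (dualMap φ) :=
  (ModuleCat.epi_iff_surjective _).2
    (LinearMap.dualMap_surjective_of_injective ((mono_iff_injective φ).1 inferInstance))

/-- Every module homomorphism from the dual of an artinian comodule to the dual of a comodule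
is a transpose. -/
theorem dualMap_surjective {M X : LeftComodule k C} [IsArtinian (DualAlgebra k C)ᵐᵒᵖ X.A] :
    Function.Surjective (dualMap : (M ⟶ X) → (X.dual ⟶ M.dual)) := by
  intro φ
  obtain ⟨W, _, ι, _⟩ := exists_mono_cofree X
  obtain ⟨ψ', hψ'⟩ := exists_dualMap_eq_of_cofree (dualMap ι ≫ φ)
  have hS := shortExact_cokernel ι
  -- Transposition is faithful, and on duals the composite factors through `dualMap (ι ≫ cokernel.π
  -- ι) = 0`. Thus `ψ'` lands in `X`.
  have hzero : ψ' ≫ cokernel.π ι = 0 := by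
    refine dualMap_injective ?_
    rw [dualMap_comp, hψ', ← Category.assoc, ← dualMap_comp, cokernel.condition]
    have h0 : ∀ A B : LeftComodule k C, dualMap (0 : A ⟶ B) = 0 := fun A B =>
      (dualMapₗ A B).map_zero
    rw [h0, h0, zero_comp]
  have : Mono (ShortComplex.mk ι (cokernel.π ι) (cokernel.condition ι)).f := ‹Mono ι›
  refine ⟨hS.exact.lift ψ' hzero, ?_⟩
  have := epi_dualMap ι
  rw [← cancel_epi (dualMap ι), ← dualMap_comp, ← hψ']
  exact congrArg dualMap (hS.exact.lift_f ψ' hzero)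

/-- Transposition as a linear equivalence on morphisms to an artinian comodule. -/
noncomputable def dualMapEquiv (M X : LeftComodule k C) [IsArtinian (DualAlgebra k C)ᵐᵒᵖ X.A] :
    (M ⟶ X) ≃ₗ[k] (X.dual ⟶ M.dual) :=
  LinearEquiv.ofBijective (dualMapₗ M X) ⟨dualMap_injective, dualMap_surjective⟩

theorem finite_dual_of_mono {X : LeftComodule k C} {W : Type u} [AddCommGroup W] [Module k W]
    [FiniteDimensional k W] (ι : X ⟶ cofree C W) [Mono ι] :
    Module.Finite (DualAlgebra k C) (X.A →ₗ[k] k) :=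
  Module.Finite.of_surjective (dualMap ι).hom
    ((ModuleCat.epi_iff_surjective _).1 (epi_dualMap ι))

/-- A finitely generated module is a quotient of the dual of a cofree comodule of finite rank. -/
theorem exists_surjective_dual_cofree (N : Type u) [AddCommGroup N] [Module (DualAlgebra k C) N]
    [Module.Finite (DualAlgebra k C) N] :
    ∃ (n : ℕ) (q : ((cofree (k := k) C (Fin n → k)).A →ₗ[k] k) →ₗ[DualAlgebra k C] N),
      Function.Surjective q := by
  obtain ⟨n, p, hp⟩ := Module.Finite.exists_fin' (DualAlgebra k C) N
  exact ⟨n, p ∘ₗ (dualCofreeEquiv (Pi.basisFun k (Fin n))).symm.toLinearMap,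
    hp.comp (LinearEquiv.surjective _)⟩

/-- Every finitely generated module over the dual algebra is the dual of a subcomodule of a
cofree comodule of finite rank. -/
theorem exists_dual_equiv (hC : IsArtinianCoalgebra k C) (N : Type u) [AddCommGroup N]
    [Module (DualAlgebra k C) N] [Module.Finite (DualAlgebra k C) N] :
    ∃ (n : ℕ) (M : LeftComodule k C) (ι : M ⟶ cofree C (Fin n → k)), Mono ι ∧
      Nonempty ((M.A →ₗ[k] k) ≃ₗ[DualAlgebra k C] N) := by
  have := hC.isNoetherianRing
  obtain ⟨n, q, hq⟩ := exists_surjective_dual_cofree (k := k) (C := C) N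
  have := isNoetherian_of_isNoetherianRing_of_finite (DualAlgebra k C)
    ((cofree (k := k) C (Fin n → k)).A →ₗ[k] k)
  obtain ⟨m, r, hr⟩ := exists_surjective_dual_cofree (k := k) (C := C) (LinearMap.ker q)
  -- Noetherianity has given a finite presentation of `N` by duals of cofree comodules. Its relation
  -- map is the transpose of some `ψ`, so `N`, the cokernel of `dualMap ψ`, is the dual of `kernel
  -- ψ`.
  obtain ⟨ψ, hψ⟩ := exists_dualMap_eq_of_cofree (C := C) (M := cofree C (Fin n → k))
    (W := Fin m → k) (ModuleCat.ofHom ((LinearMap.ker q).subtype ∘ₗ r))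
  have hψr : LinearMap.range (dualMap ψ).hom = LinearMap.ker q := by
    rw [hψ, ModuleCat.hom_ofHom, LinearMap.range_comp_of_range_eq_top _
      (LinearMap.range_eq_top.2 hr), Submodule.range_subtype]
  have hex := dualShortComplex_exact (ShortComplex.exact_kernel ψ)
  rw [ShortComplex.ShortExact.moduleCat_exact_iff_function_exact] at hex
  have hker : LinearMap.ker q = LinearMap.ker (dualMap (kernel.ι ψ)).hom :=
    hψr.symm.trans (LinearMap.exact_iff.1 hex).symm
  exact ⟨n, kernel ψ, kernel.ι ψ, inferInstance,
    ⟨((LinearMap.quotKerEquivOfSurjective (dualMap (kernel.ι ψ)).hom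
      ((ModuleCat.epi_iff_surjective _).1 (epi_dualMap _))).symm.trans
        (Submodule.quotEquivOfEq _ _ hker.symm)).trans
          (LinearMap.quotKerEquivOfSurjective q hq)⟩⟩

end LeftComodule

/-! ### Dimension shifting for `Ext` -/

section DimensionShift

universe w v t s

open Abelian

variable {A : Type t} [Category.{v} A] [Abelian A] [HasExt.{w} A]

/-- If the middle term of a short exact sequence is injective, then the connecting map identifies
`Ext (n + 1)` with a cokernel. -/
theorem nonempty_quotient_equiv_ext_succ_of_injective (R : Type s) [CommRing R] [Linear R A]
    {S : ShortComplex A} (hS : S.ShortExact) [Injective S.X₂] (M : A) (n : ℕ) :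
    Nonempty ((Ext M S.X₃ n ⧸ LinearMap.range
      ((Ext.mk₀ S.g).postcompOfLinear R M (add_zero n))) ≃ₗ[R] Ext M S.X₁ (n + 1)) := by
  let δ : Ext M S.X₃ n →ₗ[R] Ext M S.X₁ (n + 1) := hS.extClass.postcompOfLinear R M rfl
  have hδ : Function.Surjective δ := fun x =>
    Ext.covariant_sequence_exact₁ M hS x (Ext.eq_zero_of_injective _) rfl
  have hker : LinearMap.range ((Ext.mk₀ S.g).postcompOfLinear R M (add_zero n)) =
      LinearMap.ker δ := by
    ext x
    constructor
    · rintro ⟨y, rfl⟩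
      change (y.comp (Ext.mk₀ S.g) (add_zero n)).comp hS.extClass rfl = 0
      rw [Ext.comp_assoc_of_second_deg_zero, hS.comp_extClass, Ext.comp_zero]
    · exact fun hx => Ext.covariant_sequence_exact₃ M hS x rfl hx
  exact ⟨(Submodule.quotEquivOfEq _ _ hker).trans (LinearMap.quotKerEquivOfSurjective δ hδ)⟩

/-- If the middle term of a short exact sequence is projective, then the connecting map identifies
`Ext (n + 1)` with a cokernel. -/
theorem nonempty_quotient_equiv_ext_succ_of_projective (R : Type s) [CommRing R] [Linear R A]
    {S : ShortComplex A} (hS : S.ShortExact) [Projective S.X₂] (M : A) (n : ℕ) :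
    Nonempty ((Ext S.X₁ M n ⧸ LinearMap.range
      ((Ext.mk₀ S.f).precompOfLinear R M (zero_add n))) ≃ₗ[R] Ext S.X₃ M (n + 1)) := by
  let δ : Ext S.X₁ M n →ₗ[R] Ext S.X₃ M (n + 1) := hS.extClass.precompOfLinear R M (add_comm 1 n)
  have hδ : Function.Surjective δ := fun x =>
    Ext.contravariant_sequence_exact₃ hS M x (Ext.eq_zero_of_projective _) (add_comm 1 n)
  have hker : LinearMap.range ((Ext.mk₀ S.f).precompOfLinear R M (zero_add n)) =
      LinearMap.ker δ := by
    ext x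
    constructor
    · rintro ⟨y, rfl⟩
      change hS.extClass.comp ((Ext.mk₀ S.f).comp y (zero_add n)) (add_comm 1 n) = 0
      rw [← Ext.comp_assoc_of_second_deg_zero, hS.extClass_comp, Ext.zero_comp]
    · exact fun hx => Ext.contravariant_sequence_exact₁ hS M x (add_comm 1 n) hx
  exact ⟨(Submodule.quotEquivOfEq _ _ hker).trans (LinearMap.quotKerEquivOfSurjective δ hδ)⟩

/-- In positive degree `Ext` into the injective term vanishes, so the quotient is by zero. -/
theorem nonempty_ext_equiv_of_injective (R : Type s) [CommRing R] [Linear R A]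
    {S : ShortComplex A} (hS : S.ShortExact) [Injective S.X₂] (M : A) (n : ℕ) :
    Nonempty (Ext M S.X₃ (n + 1) ≃ₗ[R] Ext M S.X₁ (n + 2)) := by
  obtain ⟨e⟩ := nonempty_quotient_equiv_ext_succ_of_injective R hS M (n + 1)
  refine ⟨(Submodule.quotEquivOfEqBot _ ?_).symm.trans e⟩
  rw [Submodule.eq_bot_iff]
  rintro _ ⟨y, rfl⟩
  rw [Ext.eq_zero_of_injective y, map_zero]

theorem nonempty_ext_equiv_of_projective (R : Type s) [CommRing R] [Linear R A]
    {S : ShortComplex A} (hS : S.ShortExact) [Projective S.X₂] (M : A) (n : ℕ) :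
    Nonempty (Ext S.X₁ M (n + 1) ≃ₗ[R] Ext S.X₃ M (n + 2)) := by
  obtain ⟨e⟩ := nonempty_quotient_equiv_ext_succ_of_projective R hS M (n + 1)
  refine ⟨(Submodule.quotEquivOfEqBot _ ?_).symm.trans e⟩
  rw [Submodule.eq_bot_iff]
  rintro _ ⟨y, rfl⟩
  rw [Ext.eq_zero_of_projective y, map_zero]

end DimensionShift

/-! ### Duality for `Ext` of comodules. -/

namespace LeftComodule

variable {k C : Type u} [Field k] [AddCommGroup C] [Module k C] [Coalgebra k C]

open Abelian

/-- Transposition on `Ext⁰`. -/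
noncomputable def extZeroEquiv (M X : LeftComodule k C) [IsArtinian (DualAlgebra k C)ᵐᵒᵖ X.A] :
    Ext M X 0 ≃ₗ[k] Ext X.dual M.dual 0 :=
  (Ext.linearEquiv₀.trans (dualMapEquiv M X)).trans Ext.linearEquiv₀.symm

theorem extZeroEquiv_mk₀ {M X : LeftComodule k C} [IsArtinian (DualAlgebra k C)ᵐᵒᵖ X.A]
    (φ : M ⟶ X) : extZeroEquiv M X (Ext.mk₀ φ) = Ext.mk₀ (dualMap φ) := by
  rw [← Ext.linearEquiv₀_symm_apply (R := k), ← Ext.linearEquiv₀_symm_apply (R := k),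
    extZeroEquiv, LinearEquiv.trans_apply, LinearEquiv.trans_apply, LinearEquiv.apply_symm_apply]
  rfl

/-- Duality: `Ext` groups of comodules with artinian second argument agree with `Ext` groups of
the dual modules. -/
theorem nonempty_ext_equiv_dual (hC : IsArtinianCoalgebra k C) (M : LeftComodule k C) (n : ℕ) :
    ∀ X : LeftComodule k C, IsArtinian (DualAlgebra k C)ᵐᵒᵖ X.A →
      Nonempty (Ext M X n ≃ₗ[k] Ext X.dual M.dual n) := by
  -- One step of a resolution by cofree comodules of finite rank. The cokernel is again artinian, so
  -- the induction, which varies `X`, can continue with it.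
  have step : ∀ X : LeftComodule k C, IsArtinian (DualAlgebra k C)ᵐᵒᵖ X.A →
      ∃ S : ShortComplex (LeftComodule k C), S.ShortExact ∧ S.X₁ = X ∧ Injective S.X₂ ∧
        Projective S.X₂.dual ∧ IsArtinian (DualAlgebra k C)ᵐᵒᵖ S.X₂.A ∧
        IsArtinian (DualAlgebra k C)ᵐᵒᵖ S.X₃.A := by
    intro X _
    obtain ⟨W, _, ι, _⟩ := exists_mono_cofree X
    have h := isArtinian_cofree (W := W) hC
    exact ⟨_, shortExact_cokernel ι, rfl, inferInstanceAs (Injective (cofree C W)),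
      inferInstanceAs (Projective (cofree C W).dual), h,
      isArtinian_of_surjective _ (toLinear (cokernel.π ι))
        ((epi_iff_surjective (cokernel.π ι)).1 inferInstance)⟩
  induction n with
  | zero => exact fun X _ => ⟨extZeroEquiv M X⟩
  | succ n ih =>
    intro X hX
    obtain ⟨S, hS, rfl, _, _, _, h₃⟩ := step X hX
    have hS' := dualShortComplex_shortExact hS
    have : Projective (dualShortComplex S).X₂ := ‹Projective S.X₂.dual›
    -- Between degrees 0 and 1 both sides are cokernels, so the degree-zero isomorphism must commute
    -- with the maps induced by `S.g`. In higher degrees the shifts are isomorphisms and no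
    -- naturality is needed.
    cases n with
    | zero =>
      obtain ⟨e⟩ := nonempty_quotient_equiv_ext_succ_of_injective k hS M 0
      obtain ⟨e'⟩ := nonempty_quotient_equiv_ext_succ_of_projective k hS' M.dual 0
      refine ⟨e.symm.trans ((Submodule.Quotient.equiv _ _ (extZeroEquiv M S.X₃) ?_).trans e')⟩
      have hcomm : ((extZeroEquiv M S.X₃).toLinearMap ∘ₗ
          (Ext.mk₀ S.g).postcompOfLinear k M (add_zero 0)) =
          (Ext.mk₀ (dualMap S.g)).precompOfLinear k M.dual (zero_add 0) ∘ₗ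
            (extZeroEquiv M S.X₂).toLinearMap := by
        ext x
        obtain ⟨φ, rfl⟩ := Ext.addEquiv₀.symm.surjective x
        change extZeroEquiv M S.X₃ ((Ext.mk₀ φ).comp (Ext.mk₀ S.g) (add_zero 0)) =
          (Ext.mk₀ (dualMap S.g)).comp (extZeroEquiv M S.X₂ (Ext.mk₀ φ)) (zero_add 0)
        rw [Ext.mk₀_comp_mk₀, extZeroEquiv_mk₀, extZeroEquiv_mk₀, Ext.mk₀_comp_mk₀, dualMap_comp]
      change Submodule.map (extZeroEquiv M S.X₃).toLinearMap _ = _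
      rw [← LinearMap.range_comp, hcomm,
        LinearMap.range_comp_of_range_eq_top _ (LinearEquiv.range _)]
    | succ n =>
      obtain ⟨e⟩ := nonempty_ext_equiv_of_injective k hS M n
      obtain ⟨e'⟩ := nonempty_ext_equiv_of_projective k hS' M.dual n
      obtain ⟨e''⟩ := ih S.X₃ h₃
      exact ⟨e.symm.trans (e''.trans e')⟩

end LeftComodule

/-! ### Existence and images of simple submodules. -/

theorem isSimpleModule_map_of_ne_zero {R M N : Type*} [Ring R] [AddCommGroup M] [AddCommGroup N]
    [Module R M] [Module R N] (p : M →ₗ[R] N) (S : Submodule R M) [IsSimpleModule R S] {x : M}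
    (hx : x ∈ S) (hpx : p x ≠ 0) : IsSimpleModule R (S.map p) := by
  have hp : Function.Injective (p ∘ₗ S.subtype) :=
    (LinearMap.injective_or_eq_zero _).resolve_right fun h =>
      hpx (LinearMap.congr_fun h ⟨x, hx⟩)
  have e : S.map p = LinearMap.range (p ∘ₗ S.subtype) := by
    rw [LinearMap.range_comp, Submodule.range_subtype]
  rw [e]
  exact IsSimpleModule.congr (LinearEquiv.ofInjective _ hp).symm

theorem finiteDimensional_range_toSpanSingleton {k R M : Type*} [Field k] [Ring R] [SMul k R]
    [AddCommGroup M] [Module k M] [Module R M] [IsScalarTower k R M] {x : M} {W : Submodule k M}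
    [FiniteDimensional k W] (hW : ∀ f : R, f • x ∈ W) :
    FiniteDimensional k (LinearMap.range (LinearMap.toSpanSingleton R M x)) := by
  refine Module.Finite.of_injective (LinearMap.codRestrict W
    ((LinearMap.range (LinearMap.toSpanSingleton R M x)).subtype.restrictScalars k) ?_) ?_
  · rintro ⟨_, f, rfl⟩
    exact hW f
  · exact fun x y h => Subtype.ext (Subtype.ext_iff.1 h :)

/-- The cyclic submodule generated by `x` is finite-dimensional, hence artinian, so its submodule
lattice has an atom. -/
theorem exists_isSimpleModule_le_of_finiteDimensional {k R M : Type*} [Field k] [Ring R] [SMul k R]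
    [AddCommGroup M] [Module k M] [Module R M] [IsScalarTower k R M] {P : Submodule R M} {x : M}
    (hx : x ∈ P) (hx0 : x ≠ 0) {W : Submodule k M} [FiniteDimensional k W]
    (hW : ∀ f : R, f • x ∈ W) : ∃ N ≤ P, IsSimpleModule R N := by
  let Q := LinearMap.range (LinearMap.toSpanSingleton R M x)
  have hxQ : x ∈ Q := ⟨1, one_smul _ x⟩
  have hQP : Q ≤ P := by
    rintro _ ⟨f, rfl⟩
    exact P.smul_mem f hx
  have : FiniteDimensional k Q := finiteDimensional_range_toSpanSingleton hW
  have : IsArtinian R Q := isArtinian_of_tower k inferInstance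
  have htop : (⊤ : Submodule R Q) ≠ ⊥ := by
    intro h
    have hmem : (⟨x, hxQ⟩ : Q) ∈ (⊤ : Submodule R Q) := Submodule.mem_top
    rw [h, Submodule.mem_bot] at hmem
    exact hx0 (Subtype.ext_iff.1 hmem)
  obtain ⟨T, hT, -⟩ := (eq_bot_or_exists_atom_le (⊤ : Submodule R Q)).resolve_left htop
  have : IsSimpleModule R T := isSimpleModule_iff_isAtom.2 hT
  exact ⟨T.map Q.subtype, (Submodule.map_subtype_le Q T).trans hQP,
    IsSimpleModule.congr (Submodule.equivMapOfInjective _ Q.subtype_injective T).symm⟩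

namespace LeftComodule

variable {k C : Type u} [Field k] [AddCommGroup C] [Module k C] [Coalgebra k C]

/-! ### Quasi-finite comodules -/

/-- The inclusion of a subcomodule. -/
noncomputable def subcomoduleι (M : LeftComodule k C)
    (N : Submodule (DualAlgebra k C)ᵐᵒᵖ M.A) : M.subcomodule N ⟶ M :=
  homMk (M := M.subcomodule N) (N.restrictScalars k).subtype
    fun m => (lTensor_subtype_subCoaction M N m).symm

/-- The carrier of a subcomodule, as a module over the dual algebra. -/
noncomputable def subcomoduleToSubmodule (M : LeftComodule k C)
    (N : Submodule (DualAlgebra k C)ᵐᵒᵖ M.A) :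
    (M.subcomodule N).A →ₗ[(DualAlgebra k C)ᵐᵒᵖ] N :=
  (toLinear (M.subcomoduleι N)).codRestrict N fun m => Subtype.property (p := (· ∈ N)) m

theorem finiteDimensional_span_singleton (M : LeftComodule k C) (m : M.A) :
    FiniteDimensional k (LinearMap.range (LinearMap.toSpanSingleton (DualAlgebra k C)ᵐᵒᵖ M.A m)) :=
  have ⟨_, _, hW⟩ := M.exists_finiteDimensional_smul_mem m
  finiteDimensional_range_toSpanSingleton hW

/-- Every nonzero submodule of a comodule contains a simple one. -/
theorem exists_isSimpleModule_le (M : LeftComodule k C)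
    {P : Submodule (DualAlgebra k C)ᵐᵒᵖ M.A} (hP : P ≠ ⊥) :
    ∃ N ≤ P, IsSimpleModule (DualAlgebra k C)ᵐᵒᵖ N := by
  obtain ⟨x, hx, hx0⟩ := Submodule.exists_mem_ne_zero_of_ne_bot hP
  obtain ⟨W, _, hW⟩ := M.exists_finiteDimensional_smul_mem x
  exact exists_isSimpleModule_le_of_finiteDimensional hx hx0 hW

/-- The coefficient map `m ↦ ∑ m₋₁ χ(m₀)`. -/
noncomputable def coeff {M : LeftComodule k C} (χ : M.A →ₗ[k] k) : M.A →ₗ[k] C :=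
  cofreeSlice C LinearMap.id ∘ₗ (lift χ).f.hom

theorem coeff_smul {M : LeftComodule k C} (χ : M.A →ₗ[k] k) (f : DualAlgebra k C) (m : M.A) :
    coeff χ (MulOpposite.op f • m) = DualAlgebra.rightAct f (coeff χ m) := by
  rw [coeff, LinearMap.comp_apply, LinearMap.comp_apply, ← cofreeSlice_smul]
  exact congrArg _ ((toLinear (lift χ)).map_smul (MulOpposite.op f) m)

theorem counit_coeff {M : LeftComodule k C} (χ : M.A →ₗ[k] k) (m : M.A) :
    Coalgebra.counit (R := k) (coeff χ m) = χ m := by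
  rw [coeff, LinearMap.comp_apply, counit_cofreeSlice, cofreeCounit_lift, LinearMap.id_apply]

/-- Simple submodules of comodules are killed by the annihilator of the socle of `C`. -/
theorem smul_eq_zero_of_mem_isSimpleModule {t : Finset C}
    (ht : letI := rightDualModule k C
      ∀ N : Submodule (DualAlgebra k C)ᵐᵒᵖ C,
        IsSimpleModule (DualAlgebra k C)ᵐᵒᵖ N → ∀ c ∈ N, c ∈ Submodule.span k (t : Set C))
    (M : LeftComodule k C) (N : Submodule (DualAlgebra k C)ᵐᵒᵖ M.A)
    [IsSimpleModule (DualAlgebra k C)ᵐᵒᵖ N] {n : M.A} (hn : n ∈ N) {f : DualAlgebra k C}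
    (hf : ∀ c ∈ t, DualAlgebra.rightAct f c = 0) : MulOpposite.op f • n = 0 := by
  let _ := rightDualModule k C
  by_contra hne
  -- The coefficient map of a functional detecting `n f` carries `N` onto a simple submodule of `C`.
  -- This lies in the span of `t`, which `f` kills.
  obtain ⟨χ, hχ⟩ : ∃ χ : M.A →ₗ[k] k, χ (MulOpposite.op f • n) ≠ 0 := by
    by_contra! h
    exact hne ((Module.forall_dual_apply_eq_zero_iff k _).1 h)
  let p : M.A →ₗ[(DualAlgebra k C)ᵐᵒᵖ] C :=
    { toFun := coeff χ
      map_add' := map_add _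
      map_smul' := fun g m => coeff_smul χ g.unop m }
  have hne' : p (MulOpposite.op f • n) ≠ 0 := fun h => hχ (by
    rw [← counit_coeff, show coeff χ (MulOpposite.op f • n) = 0 from h, map_zero])
  have hsimple := isSimpleModule_map_of_ne_zero p N (N.smul_mem (MulOpposite.op f) hn) hne'
  have hspan : coeff χ n ∈ Submodule.span k (t : Set C) :=
    ht _ hsimple _ ⟨n, hn, rfl⟩
  have hker : Submodule.span k (t : Set C) ≤ LinearMap.ker (DualAlgebra.rightAct f) :=
    Submodule.span_le.2 fun c hc => hf c hc
  refine hχ ?_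
  rw [← counit_coeff, coeff_smul, LinearMap.mem_ker.1 (hker hspan), map_zero]

/-- There is a cyclic finite-dimensional comodule whose generator has as annihilator the
annihilator of a given finite subset of `C`. -/
theorem exists_cyclic (t : Finset C) :
    ∃ (K : LeftComodule k C) (_ : FiniteDimensional k K.A) (z : K.A),
      ∀ (M : LeftComodule k C) (m : M.A),
        (∀ f : DualAlgebra k C, (∀ c ∈ t, DualAlgebra.rightAct f c = 0) →
          MulOpposite.op f • m = 0) → ∃ φ : K ⟶ M, φ.f.hom z = m := by
  classical
  let E : LeftComodule k C := cofree C (t → k)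
  let b := Pi.basisFun k t
  -- Slicing `z` recovers the elements of `t`, so whatever annihilates `z` annihilates `t`, and `z ↦
  -- m` extends to the subcomodule generated by `z`.
  let z : E.A := (∑ c : t, (c : C) ⊗ₜ[k] b c : C ⊗[k] (t → k))
  have hz : ∀ c : t, cofreeSlice C (b.coord c) z = c := fun c => by
    refine (map_sum (slice C (b.coord c)) _ _).trans ?_
    rw [Finset.sum_eq_single c]
    · simp
    · intro d _ hd
      rw [slice_tmul, Module.Basis.coord_apply, Module.Basis.repr_self,
        Finsupp.single_eq_of_ne hd.symm, zero_smul]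
    · simp
  let π := LinearMap.toSpanSingleton (DualAlgebra k C)ᵐᵒᵖ E.A z
  let N := LinearMap.range π
  refine ⟨E.subcomodule N, E.finiteDimensional_span_singleton z,
    (⟨z, 1, one_smul _ z⟩ : N.restrictScalars k), fun M m hm => ?_⟩
  have hker : LinearMap.ker π ≤
      LinearMap.ker (LinearMap.toSpanSingleton (DualAlgebra k C)ᵐᵒᵖ M.A m) := by
    intro f hf
    obtain ⟨f, rfl⟩ := MulOpposite.op_surjective f
    refine hm f fun c hc => ?_
    have h := cofreeSlice_smul (b.coord ⟨c, hc⟩) f z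
    rw [show MulOpposite.op f • z = 0 from hf, map_zero, hz ⟨c, hc⟩] at h
    exact h.symm
  let θ : N →ₗ[(DualAlgebra k C)ᵐᵒᵖ] M.A :=
    ((LinearMap.ker π).liftQ _ hker) ∘ₗ π.quotKerEquivRange.symm.toLinearMap
  refine ⟨ofLinear (θ ∘ₗ E.subcomoduleToSubmodule N), ?_⟩
  change (LinearMap.ker π).liftQ _ hker (π.quotKerEquivRange.symm ⟨z, _⟩) = m
  have h1 : π.quotKerEquivRange.symm ⟨z, 1, one_smul _ z⟩ = Submodule.Quotient.mk 1 := by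
    rw [LinearEquiv.symm_apply_eq]
    exact Subtype.ext (one_smul (DualAlgebra k C)ᵐᵒᵖ z).symm
  rw [h1]
  exact one_smul (DualAlgebra k C)ᵐᵒᵖ m

/-- A quasi-finite comodule over an artinian coalgebra embeds in a cofree comodule of finite
rank. -/
theorem IsQuasiFinite.exists_mono_cofree (hC : IsArtinianCoalgebra k C) {M : LeftComodule k C}
    (hM : M.IsQuasiFinite) :
    ∃ (W : ModuleCat.{u} k) (_ : FiniteDimensional k W) (ι : M ⟶ cofree C W), Mono ι := by
  obtain ⟨t, ht⟩ := hC.exists_finset_forall_isSimpleModule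
  obtain ⟨K, hK, z, hz⟩ := exists_cyclic (k := k) t
  have hfin := hM K hK
  -- Quasi-finiteness makes the image `W` of evaluation at the generator finite-dimensional, and `W`
  -- contains the socle of `M`.
  let ev : (K ⟶ M) →ₗ[k] M.A :=
    { toFun := fun φ => φ.f.hom z
      map_add' := fun _ _ => rfl
      map_smul' := fun _ _ => rfl }
  let W := LinearMap.range ev
  have hW : ∀ N : Submodule (DualAlgebra k C)ᵐᵒᵖ M.A, IsSimpleModule (DualAlgebra k C)ᵐᵒᵖ N →
      ∀ n ∈ N, n ∈ W := fun N _ n hn =>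
    hz M n fun f hf => smul_eq_zero_of_mem_isSimpleModule ht M N hn hf
  obtain ⟨r, hr⟩ := LinearMap.exists_leftInverse_of_injective W.subtype (Submodule.ker_subtype W)
  refine ⟨ModuleCat.of k W, inferInstanceAs (FiniteDimensional k W), lift (W := W) r,
    (mono_iff_injective _).2 ?_⟩
  -- A nonzero kernel would contain a simple submodule `N` inside `W`. There the retraction `r` is
  -- the identity, yet it vanishes on the kernel.
  have hbot : LinearMap.ker (toLinear (lift (C := C) (W := W) r)) = ⊥ := by
    by_contra hne
    obtain ⟨N, hN, hsimple⟩ := M.exists_isSimpleModule_le hne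
    refine (isSimpleModule_iff_isAtom.1 hsimple).1 ((Submodule.eq_bot_iff _).2 fun n hn => ?_)
    have h1 := (lift_eq_zero_iff r n).1 (hN hn) 1
    rw [MulOpposite.op_one, one_smul] at h1
    have h2 := LinearMap.congr_fun hr ⟨n, hW N hsimple n hn⟩
    rw [LinearMap.comp_apply, Submodule.subtype_apply, h1] at h2
    exact (congrArg Subtype.val h2).symm
  exact (LinearMap.ker_eq_bot (f := toLinear (lift (C := C) (W := W) r))).1 hbot

/-- Subcomodules of cofree comodules of finite rank are quasi-finite. -/
theorem isQuasiFinite_of_mono {M : LeftComodule k C} {W : Type u} [AddCommGroup W] [Module k W]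
    [FiniteDimensional k W] (ι : M ⟶ cofree C W) [Mono ι] : M.IsQuasiFinite := by
  intro K _
  -- Composition with `ι` embeds the morphisms `K ⟶ M` into the linear maps from `K` to `W`.
  refine Module.Finite.of_injective (homCofreeToLinear K ∘ₗ Linear.rightComp k K ι) ?_
  refine (homCofreeToLinear_injective K).comp fun φ ψ h => ?_
  exact (cancel_mono ι).1 h

end LeftComodule

/-! ### Finiteness of `Ext` -/

section ExtFinite

universe w v t

open Abelian

variable {A : Type t} [Category.{v} A] [Abelian A] [HasExt.{w} A]

theorem finiteDimensional_ext_of_retract_left (k : Type*) [Field k] [Linear k A] {X X' : A}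
    (s : X ⟶ X') (r : X' ⟶ X) (h : s ≫ r = 𝟙 X) (Y : A) (n : ℕ)
    [FiniteDimensional k (Ext X' Y n)] : FiniteDimensional k (Ext X Y n) := by
  refine Module.Finite.of_injective ((Ext.mk₀ r).precompOfLinear k Y (zero_add n)) ?_
  refine Function.LeftInverse.injective
    (g := (Ext.mk₀ s).precompOfLinear k Y (zero_add n)) fun x => ?_
  change (Ext.mk₀ s).comp ((Ext.mk₀ r).comp x (zero_add n)) (zero_add n) = x
  rw [Ext.mk₀_comp_mk₀_assoc, h, Ext.mk₀_id_comp]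

theorem finiteDimensional_ext_of_retract_right (k : Type*) [Field k] [Linear k A] {Y Y' : A}
    (s : Y ⟶ Y') (r : Y' ⟶ Y) (h : s ≫ r = 𝟙 Y) (X : A) (n : ℕ)
    [FiniteDimensional k (Ext X Y' n)] : FiniteDimensional k (Ext X Y n) := by
  refine Module.Finite.of_injective ((Ext.mk₀ s).postcompOfLinear k X (add_zero n)) ?_
  refine Function.LeftInverse.injective
    (g := (Ext.mk₀ r).postcompOfLinear k X (add_zero n)) fun x => ?_
  change (x.comp (Ext.mk₀ s) (add_zero n)).comp (Ext.mk₀ r) (add_zero n) = x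
  rw [Ext.comp_assoc_of_third_deg_zero, Ext.mk₀_comp_mk₀, h, Ext.comp_mk₀_id]

theorem finiteDimensional_ext_of_shortExact (k : Type*) [Field k] [Linear k A]
    {S : ShortComplex A} (hS : S.ShortExact) (X : A) (n : ℕ)
    [FiniteDimensional k (Ext X S.X₁ n)] [FiniteDimensional k (Ext X S.X₃ n)] :
    FiniteDimensional k (Ext X S.X₂ n) := by
  have : IsNoetherian k (Ext X S.X₂ n) := by
    refine isNoetherian_of_range_eq_ker ((Ext.mk₀ S.f).postcompOfLinear k X (add_zero n))
      ((Ext.mk₀ S.g).postcompOfLinear k X (add_zero n)) ?_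
    ext x
    constructor
    · rintro ⟨y, rfl⟩
      change (y.comp (Ext.mk₀ S.f) (add_zero n)).comp (Ext.mk₀ S.g) (add_zero n) = 0
      rw [Ext.comp_assoc_of_third_deg_zero, Ext.mk₀_comp_mk₀, S.zero, Ext.mk₀_zero, Ext.comp_zero]
    · exact fun hx => Ext.covariant_sequence_exact₂ X hS x hx
  infer_instance

end ExtFinite

/-! ### Simple and finite-dimensional comodules. -/

namespace LeftComodule

variable {k C : Type u} [Field k] [AddCommGroup C] [Module k C] [Coalgebra k C]

open Abelian

/-- The `χ`-condition for simple comodules extends to finite-dimensional comodules. -/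
theorem SatisfiesChi.finiteDimensional_ext {M : LeftComodule k C} (hM : M.SatisfiesChi) (i : ℕ)
    (T : LeftComodule k C) (hT : FiniteDimensional k T.A) : FiniteDimensional k (Ext M T i) := by
  induction hd : Module.finrank k T.A using Nat.strong_induction_on generalizing T with
  | _ d ih =>
  by_cases hsimple : Simple T
  · exact hM T hsimple i
  -- The zero comodule is not simple and has no proper nonzero subobject, so it is treated
  -- separately.
  by_cases hid : 𝟙 T = 0
  · have : Subsingleton (Ext M T i) := subsingleton_of_forall_eq 0 fun x => by
      rw [← Ext.comp_mk₀_id x, hid, Ext.mk₀_zero, Ext.comp_zero]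
    infer_instance
  obtain ⟨Y, f, _, hf0, hf⟩ : ∃ (Y : LeftComodule k C) (f : Y ⟶ T), Mono f ∧ f ≠ 0 ∧ ¬ IsIso f := by
    by_contra! h
    refine hsimple ⟨fun {Y} f _ => ⟨fun hf h0 => hid ?_, h Y f inferInstance⟩⟩
    exact (IsIso.inv_hom_id f).symm.trans ((congrArg (inv f ≫ ·) h0).trans comp_zero)
  have hinj := (mono_iff_injective f).1 inferInstance
  have hsurj := (epi_iff_surjective (cokernel.π f)).1 inferInstance
  have hY : FiniteDimensional k Y.A := Module.Finite.of_injective f.f.hom hinj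
  have hQ : FiniteDimensional k (cokernel f).A :=
    Module.Finite.of_surjective (cokernel.π f).f.hom hsurj
  have hrank : Module.finrank k Y.A + Module.finrank k (cokernel f).A = Module.finrank k T.A := by
    have h1 := LinearMap.finrank_range_add_finrank_ker (cokernel.π f).f.hom
    have h2 := LinearMap.exact_iff.1 (function_exact (shortExact_cokernel f).exact)
    rw [LinearMap.range_eq_top.2 hsurj, finrank_top, h2, LinearMap.finrank_range_of_inj hinj] at h1
    omega
  have hYpos : Module.finrank k Y.A ≠ 0 := fun h => hf0 <|
    have := Module.finrank_zero_iff.1 h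
    Comonad.Coalgebra.Hom.ext (ModuleCat.hom_ext (LinearMap.ext fun y => by
      rw [Subsingleton.elim y 0, map_zero, map_zero]))
  have hQpos : Module.finrank k (cokernel f).A ≠ 0 := fun h => hf <| by
    have := Module.finrank_zero_iff.1 h
    have hπ : cokernel.π f = 0 := Comonad.Coalgebra.Hom.ext (ModuleCat.hom_ext
      (LinearMap.ext fun y => Subsingleton.elim _ _))
    have : Epi f := Preadditive.epi_of_cokernel_zero hπ
    exact isIso_of_mono_of_epi f
  have h₁ := ih _ (by omega) Y hY rfl
  have h₃ := ih _ (by omega) (cokernel f) hQ rfl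
  exact finiteDimensional_ext_of_shortExact k (shortExact_cokernel f) M i

theorem mono_of_epi_dualMap {M N : LeftComodule k C} (φ : M ⟶ N)
    (h : Function.Surjective (dualMap φ).hom) : Mono φ :=
  (mono_iff_injective φ).2 (LinearMap.dualMap_surjective_iff.1 h)

/-- A simple comodule embeds in the cofree comodule of rank one. -/
theorem exists_mono_cofree_of_simple (S : LeftComodule k C) [Simple S] :
    ∃ ι : S ⟶ cofree C k, Mono ι := by
  obtain ⟨χ, hχ⟩ : ∃ χ : S.A →ₗ[k] k, χ ≠ 0 := by
    by_contra! h
    refine id_nonzero S (dualMap_injective (ModuleCat.hom_ext (LinearMap.ext fun χ => ?_)))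
    rw [h χ, map_zero, map_zero]
  have hne : lift (C := C) χ ≠ 0 := fun h => hχ (LinearMap.ext fun s => by
    rw [← cofreeCounit_lift (C := C) χ s, h]
    exact map_zero _)
  exact ⟨lift χ, mono_of_nonzero_from_simple hne⟩

theorem isArtinian_of_mono (hC : IsArtinianCoalgebra k C) {X : LeftComodule k C} {W : Type u}
    [AddCommGroup W] [Module k W] [FiniteDimensional k W] (ι : X ⟶ cofree C W) [Mono ι] :
    IsArtinian (DualAlgebra k C)ᵐᵒᵖ X.A :=
  have := isArtinian_cofree (W := W) hC
  isArtinian_of_injective (toLinear ι) ((mono_iff_injective ι).1 inferInstance)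

/-- The dual of a simple comodule is a simple module. -/
theorem isSimpleModule_dual (hC : IsArtinianCoalgebra k C) (S : LeftComodule k C) [Simple S] :
    IsSimpleModule (DualAlgebra k C) (S.A →ₗ[k] k) := by
  obtain ⟨ι, _⟩ := exists_mono_cofree_of_simple S
  have := isArtinian_of_mono hC ι
  have := finite_dual_of_mono ι
  have hnt : Nontrivial (Submodule (DualAlgebra k C) (S.A →ₗ[k] k)) := by
    rw [Submodule.nontrivial_iff]
    by_contra h
    rw [not_nontrivial_iff_subsingleton] at h
    exact id_nonzero S (dualMap_injective (ModuleCat.hom_ext (LinearMap.ext fun χ =>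
      Subsingleton.elim _ _)))
  refine { eq_bot_or_eq_top := fun P => ?_ }
  -- The quotient by `P` is the dual of some `T`, and the projection is the transpose of a
  -- monomorphism `T ⟶ S`. As `S` is simple, this is zero or an isomorphism.
  obtain ⟨_, T, _, -, ⟨e⟩⟩ := exists_dual_equiv hC ((S.A →ₗ[k] k) ⧸ P)
  let q : (S.A →ₗ[k] k) →ₗ[DualAlgebra k C] (T.A →ₗ[k] k) := e.symm.toLinearMap ∘ₗ P.mkQ
  have hq : Function.Surjective q := e.symm.surjective.comp P.mkQ_surjective
  have hker : LinearMap.ker q = P := by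
    rw [LinearMap.ker_comp, LinearEquiv.ker, Submodule.comap_bot, Submodule.ker_mkQ]
  obtain ⟨φ, hφ⟩ := dualMap_surjective (M := T) (X := S) (ModuleCat.ofHom q)
  have : Mono φ := mono_of_epi_dualMap φ (by rw [hφ]; exact hq)
  rcases eq_or_ne φ 0 with rfl | hne
  · right
    rw [← hker, LinearMap.ker_eq_top]
    have h0 : dualMap (0 : T ⟶ S) = 0 := (dualMapₗ T S).map_zero
    rw [h0] at hφ
    exact (congrArg ModuleCat.Hom.hom hφ).symm
  · left
    have := isIso_of_mono_of_nonzero hne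
    rw [← hker, LinearMap.ker_eq_bot]
    have hs := (epi_iff_surjective φ).1 inferInstance
    have hi : Function.Injective (dualMap φ).hom := LinearMap.dualMap_injective_of_surjective hs
    rwa [hφ] at hi

end LeftComodule

/-- A simple module over a ring which is artinian modulo its radical is a direct summand of the
quotient by the radical. -/
theorem IsSimpleModule.exists_retract_quotient_jacobson (R N : Type*) [Ring R] [AddCommGroup N]
    [Module R N] [IsSimpleModule R N] [IsArtinian R (R ⧸ Ring.jacobson R)] :
    ∃ (s : N →ₗ[R] R ⧸ Ring.jacobson R) (r : (R ⧸ Ring.jacobson R) →ₗ[R] N),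
      r ∘ₗ s = LinearMap.id := by
  -- An artinian module with zero radical is semisimple, so the surjection onto `N` splits.
  have : IsSemisimpleModule R (R ⧸ Ring.jacobson R) :=
    (IsArtinian.isSemisimpleModule_iff_jacobson R _).2 (Module.jacobson_quotient_jacobson R R)
  have := IsSimpleModule.nontrivial R N
  obtain ⟨x, hx⟩ := exists_ne (0 : N)
  let r : (R ⧸ Ring.jacobson R) →ₗ[R] N :=
    (Ring.jacobson R).liftQ (LinearMap.toSpanSingleton R N x) fun a ha =>
      Module.mem_annihilator.1 (IsSemisimpleModule.jacobson_le_annihilator R N ha) x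
  have hr : Function.Surjective r := fun y => by
    obtain ⟨a, rfl⟩ := IsSimpleModule.toSpanSingleton_surjective R hx y
    exact ⟨Submodule.Quotient.mk a, rfl⟩
  obtain ⟨s, hs⟩ := IsSemisimpleModule.lifting_property r hr LinearMap.id
  exact ⟨s, r, hs⟩

/-! ### The two implications. -/

section Main

variable {k C : Type u} [Field k] [AddCommGroup C] [Module k C] [Coalgebra k C]

open Abelian LeftComodule

/-- `M*` is finitely generated and `S*` is a summand of `A/J`, so `Ext_C^i(M, S) ≅ Ext_A^i(S*, M*)`
is a summand of `Ext_A^i(A/J, M*)`. -/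
theorem IsArtinianCoalgebra.satisfiesLeftChi_of_algebra (hC : IsArtinianCoalgebra k C)
    (hA : Algebra.SatisfiesLeftChi k (DualAlgebra k C)) : Coalgebra.SatisfiesLeftChi k C := by
  intro M hM S _ i
  obtain ⟨W, _, ι, _⟩ := hM.exists_mono_cofree hC
  have := finite_dual_of_mono ι
  have := hA M.dual this i
  have := hC.finiteDimensional_quotient_jacobson
  have : IsArtinian (DualAlgebra k C) (DualAlgebra k C ⧸ Ring.jacobson (DualAlgebra k C)) :=
    isArtinian_of_tower k inferInstance
  have := isSimpleModule_dual hC S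
  obtain ⟨s, r, hrs⟩ := IsSimpleModule.exists_retract_quotient_jacobson (DualAlgebra k C)
    (S.A →ₗ[k] k)
  have : FiniteDimensional k (Ext S.dual M.dual i) :=
    finiteDimensional_ext_of_retract_left k (ModuleCat.ofHom s) (ModuleCat.ofHom r)
      (ModuleCat.hom_ext hrs) M.dual i
  obtain ⟨j, _⟩ := exists_mono_cofree_of_simple S
  obtain ⟨e⟩ := nonempty_ext_equiv_dual hC M i S (isArtinian_of_mono hC j)
  exact Module.Finite.equiv e.symm

/-- Realize `N` and `A/J` as duals of `M` and `T`. Then `T` is finite-dimensional because its dual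
is, and finiteness of `Ext_C^i(M, T)`, known from simple comodules by dévissage, passes through the
duality. -/
theorem IsArtinianCoalgebra.satisfiesLeftChi_dualAlgebra (hC : IsArtinianCoalgebra k C)
    (h : Coalgebra.SatisfiesLeftChi k C) : Algebra.SatisfiesLeftChi k (DualAlgebra k C) := by
  intro N hN i
  obtain ⟨n, M, ι, _, ⟨e⟩⟩ := exists_dual_equiv hC N
  obtain ⟨m, T, j, _, ⟨e'⟩⟩ := exists_dual_equiv hC
    (DualAlgebra k C ⧸ Ring.jacobson (DualAlgebra k C))
  have hfin := hC.finiteDimensional_quotient_jacobson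
  have hT : FiniteDimensional k (T.A →ₗ[k] k) := by
    let f : (T.A →ₗ[k] k) →ₗ[k] (DualAlgebra k C ⧸ Ring.jacobson (DualAlgebra k C)) :=
      { toFun := e'
        map_add' := map_add e'
        map_smul' := fun r x => by
          rw [← algebraMap_smul_dual, map_smul, algebraMap_smul, RingHom.id_apply] }
    exact Module.Finite.of_injective f e'.injective
  have hT' : FiniteDimensional k T.A := (Module.finite_dual_iff k).1 hT
  have hfin' := (h M (isQuasiFinite_of_mono ι)).finiteDimensional_ext i T hT'
  obtain ⟨E⟩ := nonempty_ext_equiv_dual hC M i T (isArtinian_of_mono hC j)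
  have : FiniteDimensional k (Ext T.dual M.dual i) := Module.Finite.equiv E
  have : FiniteDimensional k (Ext (ModuleCat.of (DualAlgebra k C)
      (DualAlgebra k C ⧸ Ring.jacobson (DualAlgebra k C))) M.dual i) :=
    finiteDimensional_ext_of_retract_left k e'.toModuleIso.inv e'.toModuleIso.hom
      e'.toModuleIso.inv_hom_id M.dual i
  let e'' : M.dual ≅ N := e.toModuleIso
  exact finiteDimensional_ext_of_retract_right k e''.inv e''.hom e''.inv_hom_id _ i

end Main

theorem mainTheorem8 (k : Type u) [Field k] [IsAlgClosed k] [CharZero k]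
    (C : Type u) [AddCommGroup C] [Module k C] [Coalgebra k C]
    (hC : IsArtinianCoalgebra k C) :
    (IsNoetherianRing (DualAlgebra k C) ∧ IsNoetherianRing (DualAlgebra k C)ᵐᵒᵖ ∧
      FiniteDimensional k (DualAlgebra k C ⧸ Ring.jacobson (DualAlgebra k C))) ∧
    (Coalgebra.SatisfiesLeftChi k C ↔ Algebra.SatisfiesLeftChi k (DualAlgebra k C)) :=
  ⟨⟨hC.isNoetherianRing, hC.isNoetherianRing_op, hC.finiteDimensional_quotient_jacobson⟩,
    hC.satisfiesLeftChi_dualAlgebra, hC.satisfiesLeftChi_of_algebra⟩
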